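/- **Theorem ($q$-Cayley–Hamilton–Newton theorem for the RTT-algebra).** Let $K$ be a field and let $q\in K$, $q\neq 0$, be not a root of unity. Let $V=K^N$, and let $\hat R$ be an $N^2\times N^2$ matrix acting in $V\otimes V$ which satisfies the Yang–Baxter equation $\hat R_1\hat R_2\hat R_1=\hat R_2\hat R_1\hat R_2$ on $V^{\otimes 3}$ and is of Hecke type, i.e. $\hat R=qS-q^{-1}A$ with projectors $S,A$ of arbitrary ranks, $S+A=I$. Here and below $\hat R_i$ is $\hat R$ acting in the $i$-th and $(i+1)$-st copies of $V$. Put $k_q=(q^k-q^{-k})/(q-q^{-1})$ and define the antisymmetrizers $A_k$ on $V^{\otimes k}$ by $$A_1=I,\qquad A_k=\frac1{k_q}\,A_{k-1}\bigl(q^{k-1}-(k-1)_q\,\hat R_{k-1}\bigr)A_{k-1}\quad(k\ge 2).$$ The RTT-algebra is the unital associative $K$-algebra generated by the entries of an $N\times N$ matrix $T=(T^i_j)$ with the relations $\hat R\,T_1T_2=T_1T_2\,\hat R$, where $T_a$ is $T$ acting in the $a$-th copy of $V$. For $k\ge 1$ let $\mathrm{Tr}_{(1\dots k-1)}$ and $\mathrm{Tr}_{(2\dots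 k)}$ be the partial traces over the indicated copies of $V$ in $V^{\otimes k}$, and put $$T^{\underline{[k]}}=\mathrm{Tr}_{(1\dots k-1)}(A_kT_1\cdots T_k),\qquad T^{\overline{[k]}}=\mathrm{Tr}_{(2\dots k)}(A_kT_1\cdots T_k),$$ $$T^{\underline{k}}=\mathrm{Tr}_{(1\dots k-1)}(\hat R_1\cdots\hat R_{k-1}T_1\cdots T_k),\qquad T^{\overline{k}}=\mathrm{Tr}_{(2\dots k)}(\hat R_1\cdots\hat R_{k-1}T_1\cdots T_k),$$ $$\sigma_k(T)=q^k\,\mathrm{Tr}_{(1\dots k)}(A_kT_1\cdots T_k),\qquad \sigma_0(T)=1 .$$ Then for all $k\ge 1$ $$k_q\,T^{\underline{[k]}}=-\sum_{j=0}^{k-1}(-1)^{k-j}\,\sigma_j(T)\,T^{\underline{k-j}} \qquad\text{and}\qquad k_q\,T^{\overline{[k]}}=-\sum_{j=0}^{k-1}(-1)^{k-j}\,T^{\overline{k-j}}\,\sigma_j(T).$$ Consequently, for every $n\ge 0$ with $A_{n+1}=0$, the $q$-Cayley–Hamilton identities $$\sum_{j=0}^{n}(-1)^{n+1-j}\,\sigma_j(T)\,T^{\underline{n+1-j}}=0,\qquad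 \sum_{j=0}^{n}(-1)^{n+1-j}\,T^{\overline{n+1-j}}\,\sigma_j(T)=0$$ hold. In particular they hold with $n=N$ for the standard Drinfeld–Jimbo matrix $$\hat R^{ij}_{kl}=q^{\delta_{ij}}\delta^i_l\delta^j_k+(q-q^{-1})\,\theta(l-k)\,\delta^i_k\delta^j_l$$ ($\theta(m)=1$ for $m>0$ and $\theta(m)=0$ for $m\le 0$), for which $A_{N+1}=0$. -/

import Mathlib

namespace QCHN

/-- Matrices with entries in `A` acting in `k` copies of the space `V = K^N`; the rows and columns
are labelled by multi-indices `(i_1, …, i_k)`. -/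
abbrev MultiMatrix (N k : ℕ) (A : Type*) : Type _ :=
  Matrix (Fin k → Fin N) (Fin k → Fin N) A

/-- The matrix `T` in the copy of `V` with (zero-based) number `a`, for instance
`T_1 = onCopy T 0` and `T_2 = onCopy T 1`. -/
def onCopy {N k : ℕ} {A : Type*} [Zero A] (T : Matrix (Fin N) (Fin N) A) (a : Fin k) :
    MultiMatrix N k A :=
  Matrix.of fun x y => if ∀ b, b ≠ a → x b = y b then T (x a) (y a) else 0

/-- A matrix `M` on `V ⊗ V` acting in two neighbouring copies of `V` out of `k + 1`, those with
(zero-based) numbers `a` and `a + 1`, for instance `R_1 = onPair R 0` and `R_2 = onPair R 1`. -/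
def onPair {N k : ℕ} {A : Type*} [Zero A]
    (M : Matrix (Fin N × Fin N) (Fin N × Fin N) A) (a : Fin k) : MultiMatrix N (k + 1) A :=
  Matrix.of fun x y =>
    if ∀ b, b ≠ a.castSucc → b ≠ a.succ → x b = y b then
      M (x a.castSucc, x a.succ) (y a.castSucc, y a.succ) else 0

/-- A matrix on `k` copies of `V` acting in the first `k` of `k + 1` copies, `M ⊗ I`. -/
def onFirst {N k : ℕ} {A : Type*} [Zero A] (M : MultiMatrix N k A) : MultiMatrix N (k + 1) A :=
  Matrix.of fun x y =>
    if x (Fin.last k) = y (Fin.last k) then M (Fin.init x) (Fin.init y) else 0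

/-- The partial trace over all copies of `V` but the last one. -/
def traceAllButLast {N k : ℕ} {A : Type*} [AddCommMonoid A] (M : MultiMatrix N (k + 1) A) :
    Matrix (Fin N) (Fin N) A :=
  Matrix.of fun i j => ∑ z : Fin k → Fin N,
    M (Fin.snoc (α := fun _ => Fin N) z i) (Fin.snoc (α := fun _ => Fin N) z j)

/-- The partial trace over all copies of `V` but the first one. -/
def traceAllButFirst {N k : ℕ} {A : Type*} [AddCommMonoid A] (M : MultiMatrix N (k + 1) A) :
    Matrix (Fin N) (Fin N) A :=
  Matrix.of fun i j => ∑ z : Fin k → Fin N,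
    M (Fin.cons (α := fun _ => Fin N) i z) (Fin.cons (α := fun _ => Fin N) j z)

/-- The Yang-Baxter equation (in braid form) `R_1 R_2 R_1 = R_2 R_1 R_2` on `V ⊗ V ⊗ V`. -/
def IsYangBaxter {N : ℕ} {K : Type*} [Field K]
    (R : Matrix (Fin N × Fin N) (Fin N × Fin N) K) : Prop :=
  (onPair R 0 * onPair R 1 * onPair R 0 : MultiMatrix N 3 K) =
    onPair R 1 * onPair R 0 * onPair R 1

/-- Hecke type: `R = q S - q⁻¹ A` for a pair of complementary projectors `S` and `A`, of any
ranks. -/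
def IsHecke {N : ℕ} {K : Type*} [Field K] (q : K)
    (R : Matrix (Fin N × Fin N) (Fin N × Fin N) K) : Prop :=
  ∃ S A : Matrix (Fin N × Fin N) (Fin N × Fin N) K,
    S * S = S ∧ A * A = A ∧ S + A = 1 ∧ R = q • S - q⁻¹ • A

/-- The `q`-number `k_q = (q^k - q^{-k}) / (q - q^{-1})`. -/
def qNumber {K : Type*} [Field K] (q : K) (k : ℕ) : K :=
  (q ^ k - q⁻¹ ^ k) / (q - q⁻¹)

/-- The antisymmetrizer `A_k` on `k` copies of `V`: `A_1 = I` and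
`A_k = (1 / k_q) A_{k-1} (q^{k-1} - (k-1)_q R_{k-1}) A_{k-1}`.  (`A_0` is the identity of the
one-dimensional space `V^{⊗ 0}`.) -/
def antisymmetrizer {N : ℕ} {K : Type*} [Field K] (q : K)
    (R : Matrix (Fin N × Fin N) (Fin N × Fin N) K) : (k : ℕ) → MultiMatrix N k K
  | 0 => 1
  | 1 => 1
  | k + 2 => (qNumber q (k + 2))⁻¹ •
      (onFirst (antisymmetrizer q R (k + 1)) *
        (q ^ (k + 1) • (1 : MultiMatrix N (k + 2) K) -
          qNumber q (k + 1) • onPair R (Fin.last k)) *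
        onFirst (antisymmetrizer q R (k + 1)))

/-- The matrix of free generators `t^i_j`. -/
def freeT (N : ℕ) (K : Type*) [Field K] :
    Matrix (Fin N) (Fin N) (FreeAlgebra K (Fin N × Fin N)) :=
  Matrix.of fun i j => FreeAlgebra.ι K (i, j)

/-- The entries of the matrix relation `R T_1 T_2 = T_1 T_2 R`. -/
inductive RTTRel {N : ℕ} {K : Type*} [Field K]
    (R : Matrix (Fin N × Fin N) (Fin N × Fin N) K) :
    FreeAlgebra K (Fin N × Fin N) → FreeAlgebra K (Fin N × Fin N) → Prop
  | entry (x y : Fin 2 → Fin N) : RTTRel R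
      ((onPair (R.map (algebraMap K (FreeAlgebra K (Fin N × Fin N)))) 0 *
        onCopy (freeT N K) 0 * onCopy (freeT N K) 1 : MultiMatrix N 2 _) x y)
      ((onCopy (freeT N K) 0 * onCopy (freeT N K) 1 *
        onPair (R.map (algebraMap K (FreeAlgebra K (Fin N × Fin N)))) 0 : MultiMatrix N 2 _) x y)

/-- The RTT-algebra: the unital associative `K`-algebra generated by the entries of `T`, with the
relations `R T_1 T_2 = T_1 T_2 R`. -/
abbrev RTTAlgebra {N : ℕ} {K : Type*} [Field K]
    (R : Matrix (Fin N × Fin N) (Fin N × Fin N) K) : Type _ :=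
  RingQuot (RTTRel R)

/-- The matrix `T` of generators of the RTT-algebra. -/
def rttT {N : ℕ} {K : Type*} [Field K] (R : Matrix (Fin N × Fin N) (Fin N × Fin N) K) :
    Matrix (Fin N) (Fin N) (RTTAlgebra R) :=
  (freeT N K).map (RingQuot.mkAlgHom K (RTTRel R))

/-- The product `T_1 T_2 ⋯ T_k` on `k` copies of `V`. -/
def prodT {N : ℕ} {K : Type*} [Field K] (R : Matrix (Fin N × Fin N) (Fin N × Fin N) K)
    (k : ℕ) : MultiMatrix N k (RTTAlgebra R) :=
  (List.ofFn fun a : Fin k => (onCopy (rttT R) a : MultiMatrix N k (RTTAlgebra R))).prod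

/-- The operator `A_k T_1 ⋯ T_k`. -/
def antisymProd {N : ℕ} {K : Type*} [Field K] (q : K)
    (R : Matrix (Fin N × Fin N) (Fin N × Fin N) K) (k : ℕ) : MultiMatrix N k (RTTAlgebra R) :=
  (antisymmetrizer q R k).map (algebraMap K (RTTAlgebra R)) * prodT R k

/-- The operator `R_1 R_2 ⋯ R_k T_1 T_2 ⋯ T_{k+1}` on `k + 1` copies of `V`. -/
def braidProd {N : ℕ} {K : Type*} [Field K]
    (R : Matrix (Fin N × Fin N) (Fin N × Fin N) K) (k : ℕ) :
    MultiMatrix N (k + 1) (RTTAlgebra R) :=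
  (List.ofFn fun a : Fin k => (onPair (R.map (algebraMap K (RTTAlgebra R))) a :
    MultiMatrix N (k + 1) (RTTAlgebra R))).prod * prodT R (k + 1)

/-- `σ_k(T) = q^k Tr_{(1…k)} (A_k T_1 ⋯ T_k)`; in particular `σ_0(T) = 1`. -/
def sigma {N : ℕ} {K : Type*} [Field K] (q : K)
    (R : Matrix (Fin N × Fin N) (Fin N × Fin N) K) (k : ℕ) : RTTAlgebra R :=
  q ^ k • (antisymProd q R k).trace

/-- The wedge power `T^{\underline{[k]}} = Tr_{(1…k-1)} (A_k T_1 ⋯ T_k)`, for `k ≥ 1`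
(the value at `k = 0` is a dummy). -/
def wedgeLower {N : ℕ} {K : Type*} [Field K] (q : K)
    (R : Matrix (Fin N × Fin N) (Fin N × Fin N) K) :
    ℕ → Matrix (Fin N) (Fin N) (RTTAlgebra R)
  | 0 => 0
  | k + 1 => traceAllButLast (antisymProd q R (k + 1))

/-- The wedge power `T^{\overline{[k]}} = Tr_{(2…k)} (A_k T_1 ⋯ T_k)`, for `k ≥ 1`
(the value at `k = 0` is a dummy). -/
def wedgeUpper {N : ℕ} {K : Type*} [Field K] (q : K)
    (R : Matrix (Fin N × Fin N) (Fin N × Fin N) K) :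
    ℕ → Matrix (Fin N) (Fin N) (RTTAlgebra R)
  | 0 => 0
  | k + 1 => traceAllButFirst (antisymProd q R (k + 1))

/-- The power `T^{\underline{k}} = Tr_{(1…k-1)} (R_1 ⋯ R_{k-1} T_1 ⋯ T_k)`, for `k ≥ 1`
(the value at `k = 0` is a dummy). -/
def powLower {N : ℕ} {K : Type*} [Field K]
    (R : Matrix (Fin N × Fin N) (Fin N × Fin N) K) :
    ℕ → Matrix (Fin N) (Fin N) (RTTAlgebra R)
  | 0 => 0
  | k + 1 => traceAllButLast (braidProd R k)

/-- The power `T^{\overline{k}} = Tr_{(2…k)} (R_1 ⋯ R_{k-1} T_1 ⋯ T_k)`, for `k ≥ 1`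
(the value at `k = 0` is a dummy). -/
def powUpper {N : ℕ} {K : Type*} [Field K]
    (R : Matrix (Fin N × Fin N) (Fin N × Fin N) K) :
    ℕ → Matrix (Fin N) (Fin N) (RTTAlgebra R)
  | 0 => 0
  | k + 1 => traceAllButFirst (braidProd R k)

/-- The product `σ M`: every entry of `M` is multiplied by `σ` from the left. -/
def leftMul {N : ℕ} {A : Type*} [Mul A] (s : A) (M : Matrix (Fin N) (Fin N) A) :
    Matrix (Fin N) (Fin N) A :=
  Matrix.of fun i j => s * M i j

/-- The product `M σ`: every entry of `M` is multiplied by `σ` from the right. -/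
def rightMul {N : ℕ} {A : Type*} [Mul A] (M : Matrix (Fin N) (Fin N) A) (s : A) :
    Matrix (Fin N) (Fin N) A :=
  Matrix.of fun i j => M i j * s

/-- The standard Drinfeld-Jimbo matrix
`R^{ij}_{kl} = q^{δ_ij} δ^i_l δ^j_k + (q - q⁻¹) θ(l - k) δ^i_k δ^j_l`, where `θ(m) = 1` for
`m > 0` and `θ(m) = 0` for `m ≤ 0`. -/
def drinfeldJimbo (N : ℕ) {K : Type*} [Field K] (q : K) :
    Matrix (Fin N × Fin N) (Fin N × Fin N) K :=
  Matrix.of fun x y =>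
    (if x.1 = x.2 then q else 1) * (if x.1 = y.2 ∧ x.2 = y.1 then 1 else 0) +
      (q - q⁻¹) * (if y.1 < y.2 then 1 else 0) * (if x.1 = y.1 ∧ x.2 = y.2 then 1 else 0)

end QCHN

namespace QCHN

/-! ### Antisymmetrizers in an abstract Hecke algebra. -/

section HeckeAlgebra

variable {K M : Type*} [Field K] [Ring M] [Algebra K M]

/-! Fix `k` and number the generators from one. With the trace over copies `1, …, k-1`, put X_j =
q^j Tr(A_j R_{j+1}⋯R_{k-1} T_1⋯T_k) and Z_j = (j+1)_q Tr(A_{j+1} R_{j+1}⋯R_{k-1} T_1⋯T_k), for 0 ≤ j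
< k. In X_j the operators A_j and R_{j+1}⋯R_{k-1} live on complementary blocks of copies, so the
trace factors and X_j = σ_j(T) T^{\underline{k-j}} (`leftMul_sigma_powLower`). At the other end,
Z_{k-1} = k_q T^{\underline{[k]}}.

The recursion for the antisymmetrizers reads q^j A_j = (j+1)_q A_{j+1} + j_q A_j R_j A_j. Inserted
into X_j, its first term gives Z_j. In the second, the right-hand A_j commutes with R_{j+1}⋯R_{k-1}
and, by the RTT relations, with T_1⋯T_k; it acts only in traced copies, so it can be cycled to the
front and absorbed by A_j A_j = A_j, leaving Z_{j-1}. Hence X_0 = Z_0 and X_j = Z_j + Z_{j-1}, and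
solving for Z_{k-1} gives the alternating sum. This argument needs only the Hecke relations, a
linear map cyclic in the relevant generators, and an element T commuting with all of them:
`hecke_newton_increasing`.

The upper identity is the mirror image: the generators are numbered backwards, and A_k does not
change (`heckeAntisymmetrizer_reverse`). The essential Hecke-algebra input is
`heckeAntisymmetrizer_spec`: A_k is idempotent and killed on both sides by every R_i + q⁻¹. If
A_{n+1} = 0 the wedge powers vanish, which gives Cayley–Hamilton. For the Drinfeld–Jimbo matrix, a
vector killed by all R_i + q⁻¹ vanishes at multi-indices with a repetition, and N + 1 indices among
N values always repeat. -/

theorem q_sub_inv_ne_zero {q : K} (hq0 : q ≠ 0) (hq : ∀ m : ℕ, 0 < m → q ^ m ≠ 1) :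
    q - q⁻¹ ≠ 0 := by
  intro h
  apply hq 2 (by norm_num)
  field_simp at h
  linear_combination h

theorem qNumber_ne_zero {q : K} (hq0 : q ≠ 0) (hq : ∀ m : ℕ, 0 < m → q ^ m ≠ 1) {k : ℕ}
    (hk : 0 < k) : qNumber q k ≠ 0 := by
  refine div_ne_zero (fun h => hq (k + k) (by omega) ?_) (q_sub_inv_ne_zero hq0 hq)
  rw [inv_pow, sub_eq_zero] at h
  rw [pow_add]
  nth_rw 2 [h]
  exact mul_inv_cancel₀ (pow_ne_zero _ hq0)

theorem qNumber_zero (q : K) : qNumber q 0 = 0 := by simp [qNumber]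

theorem qNumber_one {q : K} (h : q - q⁻¹ ≠ 0) : qNumber q 1 = 1 := by
  simp [qNumber, div_self h]

theorem qNumber_succ {q : K} (hq0 : q ≠ 0) (h : q - q⁻¹ ≠ 0) (k : ℕ) :
    qNumber q (k + 1) = q ^ k + qNumber q k * q⁻¹ := by
  rw [qNumber, qNumber, div_eq_iff h, add_mul, mul_right_comm, div_mul_cancel₀ _ h, pow_succ,
    pow_succ, mul_sub]
  field_simp
  ring

theorem qNumber_add_two {q : K} (hq0 : q ≠ 0) (h : q - q⁻¹ ≠ 0) (k : ℕ) :
    qNumber q (k + 2) = (q + q⁻¹) * qNumber q (k + 1) - qNumber q k := by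
  simp only [qNumber]
  rw [div_eq_iff h, sub_mul, mul_assoc, div_mul_cancel₀ _ h, div_mul_cancel₀ _ h]
  have : q * q⁻¹ = 1 := mul_inv_cancel₀ hq0
  linear_combination (q⁻¹ ^ k - q ^ k) * this

/-- The antisymmetrizers built from a sequence `r` of elements of an algebra. -/
def heckeAntisymmetrizer (q : K) (r : ℕ → M) : ℕ → M
  | 0 => 1
  | 1 => 1
  | k + 2 => (qNumber q (k + 2))⁻¹ •
      (heckeAntisymmetrizer q r (k + 1) *
        (q ^ (k + 1) • (1 : M) - qNumber q (k + 1) • r k) *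
        heckeAntisymmetrizer q r (k + 1))

/-- The first `k - 1` terms of `r` satisfy the defining relations of the Hecke algebra `H_k(q)`. -/
structure IsHeckeFamily (q : K) (r : ℕ → M) (k : ℕ) : Prop where
  quadratic : ∀ i, i + 1 < k → (r i - q • (1 : M)) * (r i + q⁻¹ • (1 : M)) = 0
  braid : ∀ i, i + 2 < k → r i * r (i + 1) * r i = r (i + 1) * r i * r (i + 1)
  commute : ∀ i j, i + 1 < j → j + 1 < k → Commute (r i) (r j)

theorem heckeAntisymmetrizer_congr (q : K) {r s : ℕ → M} :
    ∀ {k : ℕ}, (∀ i, i + 1 < k → r i = s i) →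
      heckeAntisymmetrizer q r k = heckeAntisymmetrizer q s k
  | 0, _ => rfl
  | 1, _ => rfl
  | k + 2, h => by
    rw [heckeAntisymmetrizer, heckeAntisymmetrizer, h k (by omega),
      heckeAntisymmetrizer_congr q (k := k + 1) fun i hi => h i (by omega)]

theorem map_heckeAntisymmetrizer {M' : Type*} [Ring M'] [Algebra K M'] (φ : M →ₐ[K] M') (q : K)
    (r : ℕ → M) :
    ∀ k : ℕ, φ (heckeAntisymmetrizer q r k) = heckeAntisymmetrizer q (fun i => φ (r i)) k
  | 0 => map_one φ
  | 1 => map_one φ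
  | k + 2 => by
    simp only [heckeAntisymmetrizer, map_smul, map_mul, map_sub, map_one,
      map_heckeAntisymmetrizer φ q r (k + 1)]

/-- The k-th antisymmetrizer is a polynomial in the first k - 1 generators. Applied to a centralizer
and to `cyclicSubalgebra`, this extends commutation and cyclicity from generators to
antisymmetrizers. -/
theorem heckeAntisymmetrizer_mem (q : K) {r : ℕ → M} (S : Subalgebra K M) :
    ∀ {k : ℕ}, (∀ i, i + 1 < k → r i ∈ S) → heckeAntisymmetrizer q r k ∈ S
  | 0, _ => S.one_mem
  | 1, _ => S.one_mem
  | k + 2, h => by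
    have ih := heckeAntisymmetrizer_mem q S (k := k + 1) fun i hi => h i (by omega)
    exact S.smul_mem (S.mul_mem (S.mul_mem ih (S.sub_mem (S.smul_mem S.one_mem _)
      (S.smul_mem (h k (by omega)) _))) ih) _

theorem commute_heckeAntisymmetrizer (q : K) {r : ℕ → M} {k : ℕ} {x : M}
    (h : ∀ i, i + 1 < k → Commute (r i) x) : Commute (heckeAntisymmetrizer q r k) x := by
  have := heckeAntisymmetrizer_mem q (r := r) (Subalgebra.centralizer K {x}) (k := k)
    fun i hi => Subalgebra.mem_centralizer_iff K |>.2 fun g hg => by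
      rw [Set.mem_singleton_iff.1 hg]; exact (h i hi).eq.symm
  exact ((Subalgebra.mem_centralizer_iff K).1 this x rfl).symm

/-- Elements that may be moved around under `τ` form a subalgebra. -/
def cyclicSubalgebra {W : Type*} [AddCommGroup W] [Module K W] (τ : M →ₗ[K] W) :
    Subalgebra K M where
  carrier := {x | ∀ y, τ (x * y) = τ (y * x)}
  mul_mem' {a b} ha hb y := by
    rw [mul_assoc, ha, mul_assoc, hb, mul_assoc]
  add_mem' {a b} ha hb y := by
    rw [add_mul, mul_add, map_add, map_add, ha, hb]
  algebraMap_mem' c y := by rw [Algebra.commutes]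

theorem IsHeckeFamily.reverse {q : K} {r : ℕ → M} {k : ℕ} (h : IsHeckeFamily q r k) :
    IsHeckeFamily q (fun i => r (k - 2 - i)) k := by
  refine ⟨fun i hi => h.quadratic _ (by omega), fun i hi => ?_, fun i j hij hj => ?_⟩
  · have := h.braid (k - 2 - (i + 1)) (by omega)
    rw [show k - 2 - (i + 1) + 1 = k - 2 - i by omega] at this
    exact this.symm
  · exact (h.commute _ _ (by omega) (by omega)).symm

theorem IsHeckeFamily.shift {q : K} {r : ℕ → M} {k l m : ℕ} (h : IsHeckeFamily q r k)
    (hl : m + l ≤ k) : IsHeckeFamily q (fun i => r (m + i)) l :=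
  ⟨fun i hi => h.quadratic _ (by omega), fun i hi => h.braid (m + i) (by omega),
    fun i j hij hj => h.commute _ _ (by omega) (by omega)⟩

variable {q : K} (hq0 : q ≠ 0) (hq : ∀ m : ℕ, 0 < m → q ^ m ≠ 1) {r : ℕ → M} {n : ℕ}

theorem IsHeckeFamily.sq (h : IsHeckeFamily q r n) {i : ℕ} (hi : i + 1 < n) :
    (r i + q⁻¹ • (1 : M)) * (r i + q⁻¹ • (1 : M)) = (q + q⁻¹) • (r i + q⁻¹ • (1 : M)) := by
  have := h.quadratic i hi
  rw [sub_mul, sub_eq_zero, smul_one_mul] at this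
  rw [add_mul, this, smul_one_mul, add_smul]

/-- For the generators shifted by q⁻¹, which are multiples of projectors, the braid relation becomes
the Temperley–Lieb-like EFE - E = FEF - F; the quadratic relations absorb the other terms. -/
theorem IsHeckeFamily.braid_shifted (hq0 : q ≠ 0) (h : IsHeckeFamily q r n) {i : ℕ}
    (hi : i + 2 < n) {E F : M} (hE : E = r (i + 1) + q⁻¹ • (1 : M))
    (hF : F = r i + q⁻¹ • (1 : M)) : E * F * E = E + F * E * F - F := by
  have hb := h.braid i hi
  have h1 := h.sq (i := i) (by omega)
  have h2 := h.sq (i := i + 1) (by omega)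
  rw [← hF] at h1
  rw [← hE] at h2
  have e1 : r i = F - q⁻¹ • 1 := by rw [hF]; abel
  have e2 : r (i + 1) = E - q⁻¹ • 1 := by rw [hE]; abel
  rw [e1, e2] at hb
  simp only [sub_mul, mul_sub, smul_mul_assoc, mul_smul_comm, one_mul, mul_one, h1, h2] at hb
  have hs : q⁻¹ • ((q + q⁻¹) • E) = E + (q⁻¹ * q⁻¹) • E := by
    rw [smul_smul, mul_add, inv_mul_cancel₀ hq0, add_smul, one_smul]
  have hs' : q⁻¹ • ((q + q⁻¹) • F) = F + (q⁻¹ * q⁻¹) • F := by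
    rw [smul_smul, mul_add, inv_mul_cancel₀ hq0, add_smul, one_smul]
  simp only [smul_sub, hs, hs', smul_smul] at hb
  rw [← sub_eq_zero] at hb ⊢
  rw [← neg_eq_zero, ← hb]
  abel

include hq0 hq in
-- Since q^(k+1) = (k+2)_q - (k+1)_q q⁻¹, the middle factor of the recursion is a multiple of 1
-- minus a multiple of E = r_k + q⁻¹, the element the antisymmetrizers annihilate.
theorem heckeAntisymmetrizer_add_two (r : ℕ → M) (k : ℕ) :
    heckeAntisymmetrizer q r (k + 2) =
      heckeAntisymmetrizer q r (k + 1) * heckeAntisymmetrizer q r (k + 1) -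
      (qNumber q (k + 1) / qNumber q (k + 2)) • (heckeAntisymmetrizer q r (k + 1) *
        (r k + q⁻¹ • (1 : M)) * heckeAntisymmetrizer q r (k + 1)) := by
  have h0 := qNumber_ne_zero hq0 hq (k := k + 2) (by omega)
  have h1 := qNumber_succ hq0 (q_sub_inv_ne_zero hq0 hq) (k + 1)
  have : (q ^ (k + 1) • (1 : M) - qNumber q (k + 1) • r k) =
      qNumber q (k + 2) • (1 : M) - qNumber q (k + 1) • (r k + q⁻¹ • (1 : M)) := by
    rw [h1, add_smul, smul_add, smul_smul]; abel
  rw [heckeAntisymmetrizer, this, mul_sub, sub_mul, smul_sub, mul_smul_comm, mul_one,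
    smul_mul_assoc, smul_smul, inv_mul_cancel₀ h0, one_smul, mul_smul_comm, smul_mul_assoc,
    smul_smul, div_eq_inv_mul]

/-- Induction on k. Only annihilation by the newest shifted generator E is not inherited; it amounts
to EAEA being the right multiple of EA, and to its mirror image. Idempotence then follows from the
recursion. -/
theorem heckeAntisymmetrizer_spec (hq0 : q ≠ 0) (hq : ∀ m : ℕ, 0 < m → q ^ m ≠ 1)
    (h : IsHeckeFamily q r n) : ∀ k ≤ n,
      (∀ i, i + 1 < k → (r i + q⁻¹ • (1 : M)) * heckeAntisymmetrizer q r k = 0 ∧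
        heckeAntisymmetrizer q r k * (r i + q⁻¹ • (1 : M)) = 0) ∧
      heckeAntisymmetrizer q r k * heckeAntisymmetrizer q r k = heckeAntisymmetrizer q r k
  | 0, _ => ⟨fun i hi => by omega, one_mul _⟩
  | 1, _ => ⟨fun i hi => by omega, one_mul _⟩
  | k + 2, hk => by
    obtain ⟨ihE, ihA⟩ := heckeAntisymmetrizer_spec hq0 hq h (k + 1) (by omega)
    have ihB := (heckeAntisymmetrizer_spec hq0 hq h k (by omega)).2
    have hrec := heckeAntisymmetrizer_add_two hq0 hq r k
    rw [ihA] at hrec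
    set A := heckeAntisymmetrizer q r (k + 1) with hA
    set A' := heckeAntisymmetrizer q r (k + 2)
    set E := r k + q⁻¹ • (1 : M) with hE
    have h0 := qNumber_ne_zero hq0 hq (k := k + 2) (by omega)
    have key : E * A * E * A = (qNumber q (k + 2) / qNumber q (k + 1)) • (E * A) ∧
        A * E * A * E = (qNumber q (k + 2) / qNumber q (k + 1)) • (A * E) := by
      have hsq : E * E = (q + q⁻¹) • E := h.sq (by omega)
      have hn := q_sub_inv_ne_zero hq0 hq
      have h2 := qNumber_add_two hq0 hn k
      -- For A = 1 the claim is just E² = (q + q⁻¹)E. Otherwise A is expanded once more, through its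
      -- predecessor B, which commutes with E.
      rcases k with _ | k
      · have : A = 1 := rfl
        rw [this, mul_one, mul_one, one_mul, mul_one, hsq, h2, qNumber_zero,
          zero_add, qNumber_one hn]
        simp
      · have hrecA := heckeAntisymmetrizer_add_two hq0 hq r k
        rw [ihB] at hrecA
        have hBE : Commute (heckeAntisymmetrizer q r (k + 1)) E :=
          commute_heckeAntisymmetrizer q fun i hi =>
            (h.commute i (k + 1) (by omega) (by omega)).add_right
              ((Commute.one_right _).smul_right _)
        set B := heckeAntisymmetrizer q r (k + 1)
        set F := r k + q⁻¹ • (1 : M) with hF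
        obtain ⟨hFA, hAF⟩ := ihE k (by omega)
        have hBA : B * A = A := by
          rw [hA, hrecA, mul_sub, ihB, mul_smul_comm, ← mul_assoc, ← mul_assoc, ihB]
        have hAB : A * B = A := by
          rw [hA, hrecA, sub_mul, ihB, smul_mul_assoc, mul_assoc _ B B, ihB]
        have hbr : E * F * E = E + F * E * F - F := h.braid_shifted hq0 (by omega) hE hF
        set c := qNumber q (k + 1) / qNumber q (k + 1 + 1) with hc
        -- After EFE is replaced by E + FEF - F, multiplication by A leaves only E, because F
        -- annihilates A.
        have hEAE : E * A * E = (q + q⁻¹) • (B * E) - c • (B * (E + F * E * F - F) * B) := by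
          rw [← hbr, hA, hrecA, mul_sub, sub_mul, ← hBE.eq, mul_assoc, hsq, mul_smul_comm,
            mul_smul_comm, smul_mul_assoc]
          congr 2
          calc E * (B * F * B) * E = (E * B) * F * (B * E) := by simp only [mul_assoc]
            _ = (B * E) * F * (E * B) := by rw [hBE.eq]
            _ = _ := by simp only [mul_assoc]
        have h1 := qNumber_ne_zero hq0 hq (k := k + 1 + 1) (by omega)
        have hcoef : qNumber q (k + 1 + 2) / qNumber q (k + 1 + 1) = (q + q⁻¹) - c := by
          rw [hc, h2]; field_simp
        rw [hcoef]
        constructor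
        · have hX : (E + F * E * F - F) * A = E * A := by
            rw [sub_mul, add_mul, mul_assoc _ F A, hFA, mul_zero, add_zero, sub_zero]
          have hBEA : B * (E * A) = E * A := by rw [← mul_assoc, hBE.eq, mul_assoc, hBA]
          rw [hEAE, sub_mul, smul_mul_assoc, smul_mul_assoc, mul_assoc _ B A, hBA, mul_assoc B E A,
            mul_assoc B (_ - _) A, hX, hBEA, sub_smul]
        · have hX : A * (E + F * E * F - F) = A * E := by
            rw [mul_sub, mul_add, mul_assoc F, ← mul_assoc A F, hAF, zero_mul, add_zero, sub_zero]
          have hAEB : A * E * B = A * E := by rw [mul_assoc, ← hBE.eq, ← mul_assoc, hAB]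
          rw [mul_assoc, mul_assoc, ← mul_assoc E, hEAE, mul_sub, mul_smul_comm, mul_smul_comm,
            ← mul_assoc A B E, hAB, mul_assoc B, ← mul_assoc A B, hAB, ← mul_assoc, hX, hAEB,
            sub_smul]
    have h1 := qNumber_ne_zero hq0 hq (k := k + 1) (by omega)
    have hAA' : A * A' = A' := by
      rw [hrec, mul_sub, ihA, mul_smul_comm, ← mul_assoc, ← mul_assoc, ihA]
    have hA'A : A' * A = A' := by
      rw [hrec, sub_mul, ihA, smul_mul_assoc, mul_assoc _ A A, ihA]
    have hlast : E * A' = 0 ∧ A' * E = 0 := by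
      constructor
      · rw [hrec, mul_sub, mul_smul_comm, ← mul_assoc, ← mul_assoc, key.1, smul_smul,
          div_mul_div_cancel₀ h0, div_self h1, one_smul, sub_self]
      · rw [hrec, sub_mul, smul_mul_assoc, key.2, smul_smul,
          div_mul_div_cancel₀ h0, div_self h1, one_smul, sub_self]
    refine ⟨fun i hi => ?_, ?_⟩
    · rcases Nat.lt_or_ge (i + 1) (k + 1) with hi' | hi'
      · constructor
        · rw [← hAA', ← mul_assoc, (ihE i hi').1, zero_mul]
        · rw [← hA'A, mul_assoc, (ihE i hi').2, mul_zero]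
      · obtain rfl : i = k := by omega
        exact hlast
    · nth_rw 2 [hrec]
      rw [mul_sub, hA'A, mul_smul_comm, ← mul_assoc, ← mul_assoc, hA'A, hlast.2, zero_mul,
        smul_zero, sub_zero]

include hq0 hq in
-- Every correction term of the recursion ends in a shifted generator applied to y. Together with
-- `heckeAntisymmetrizer_spec` this characterizes the antisymmetrizer uniquely.
theorem heckeAntisymmetrizer_mul_of_annihilates (r : ℕ → M) {y : M} :
    ∀ {k : ℕ}, (∀ i, i + 1 < k → (r i + q⁻¹ • (1 : M)) * y = 0) →
      heckeAntisymmetrizer q r k * y = y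
  | 0, _ => one_mul _
  | 1, _ => one_mul _
  | k + 2, h => by
    have ih := heckeAntisymmetrizer_mul_of_annihilates r (k := k + 1) fun i hi => h i (by omega)
    rw [heckeAntisymmetrizer_add_two hq0 hq, sub_mul, smul_mul_assoc, mul_assoc _ _ y, ih,
      mul_assoc _ _ y, ih, mul_assoc, h k (by omega), mul_zero, smul_zero, sub_zero]

include hq0 hq in
theorem mul_heckeAntisymmetrizer_of_annihilates (r : ℕ → M) {y : M} :
    ∀ {k : ℕ}, (∀ i, i + 1 < k → y * (r i + q⁻¹ • (1 : M)) = 0) →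
      y * heckeAntisymmetrizer q r k = y
  | 0, _ => mul_one _
  | 1, _ => mul_one _
  | k + 2, h => by
    have ih := mul_heckeAntisymmetrizer_of_annihilates r (k := k + 1) fun i hi => h i (by omega)
    rw [heckeAntisymmetrizer_add_two hq0 hq, mul_sub, mul_smul_comm, ← mul_assoc, ih,
      ← mul_assoc, ← mul_assoc, ih, h k (by omega), zero_mul, smul_zero, sub_zero]

include hq0 hq in
-- Both antisymmetrizers are annihilated by the same set of shifted generators, so their product
-- equals each of them.
theorem heckeAntisymmetrizer_reverse (h : IsHeckeFamily q r n) :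
    heckeAntisymmetrizer q (fun i => r (n - 2 - i)) n = heckeAntisymmetrizer q r n := by
  have h1 := (heckeAntisymmetrizer_spec hq0 hq h n le_rfl).1
  have h2 := (heckeAntisymmetrizer_spec hq0 hq h.reverse n le_rfl).1
  rw [← heckeAntisymmetrizer_mul_of_annihilates hq0 hq (fun i => r (n - 2 - i))
    (y := heckeAntisymmetrizer q r n) (k := n) fun i hi => (h1 _ (by omega)).1]
  refine (mul_heckeAntisymmetrizer_of_annihilates hq0 hq r fun i hi => ?_).symm
  have := (h2 (n - 2 - i) (by omega)).2
  rwa [show n - 2 - (n - 2 - i) = i by omega] at this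

theorem pow_smul_heckeAntisymmetrizer (hq0 : q ≠ 0) (hq : ∀ m : ℕ, 0 < m → q ^ m ≠ 1)
    (h : IsHeckeFamily q r n) {m : ℕ} (hm : m + 1 ≤ n) :
    q ^ (m + 1) • heckeAntisymmetrizer q r (m + 1) =
      qNumber q (m + 2) • heckeAntisymmetrizer q r (m + 2) + qNumber q (m + 1) •
        (heckeAntisymmetrizer q r (m + 1) * r m * heckeAntisymmetrizer q r (m + 1)) := by
  have hA := (heckeAntisymmetrizer_spec hq0 hq h (m + 1) hm).2
  rw [heckeAntisymmetrizer, smul_smul, mul_inv_cancel₀ (qNumber_ne_zero hq0 hq (by omega)),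
    one_smul, mul_sub, sub_mul, mul_smul_comm, mul_one, smul_mul_assoc, hA, mul_smul_comm,
    smul_mul_assoc, sub_add_cancel]

/-! ### The Newton recursion under a cyclic linear map. -/

variable {W : Type*} [AddCommGroup W] [Module K W]

/-- Iterates Z_{m+1} = X_{m+1} - Z_m; the sign -(-1)^(n+1-j) is (-1)^(n-j). -/
theorem qNumber_smul_eq_neg_sum {n : ℕ} {X Z : ℕ → W} (h0 : X 0 = Z 0)
    (hs : ∀ m < n, X (m + 1) = Z (m + 1) + Z m) :
    Z n = -∑ j ∈ Finset.range (n + 1), (-1 : K) ^ (n + 1 - j) • X j := by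
  induction n with
  | zero => simp [h0]
  | succ n ih =>
    rw [Finset.sum_range_succ, eq_sub_of_add_eq (hs n (by omega)).symm,
      ih fun m hm => hs m (by omega), sub_neg_eq_add, neg_add, add_comm (X _),
      ← Finset.sum_neg_distrib]
    congr 1
    · refine Finset.sum_congr rfl fun j hj => ?_
      have := Finset.mem_range.1 hj
      rw [show n + 1 + 1 - j = (n + 1 - j) + 1 by omega, pow_succ, mul_neg_one, neg_smul, neg_neg]
    · simp

include hq0 hq in
/-- The Cayley-Hamilton-Newton identity for products of generators in increasing order. -/
theorem hecke_newton_increasing (h : IsHeckeFamily q r (n + 1)) (τ : M →ₗ[K] W) (T : M)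
    (hT : ∀ i < n, Commute (r i) T) (hτ : ∀ i, i + 1 < n → ∀ y, τ (r i * y) = τ (y * r i))
    (P : ℕ → M) (hPn : P n = 1) (hP : ∀ j < n, P j = r j * P (j + 1)) :
    qNumber q (n + 1) • τ (heckeAntisymmetrizer q r (n + 1) * T) =
      -∑ j ∈ Finset.range (n + 1), (-1 : K) ^ (n + 1 - j) •
        q ^ j • τ (heckeAntisymmetrizer q r j * P j * T) := by
  have hcomm : ∀ i j, i + 1 < j → j ≤ n → Commute (r i) (P j) := by
    intro i j hij hj
    induction hj using Nat.decreasingInduction with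
    | self => rw [hPn]; exact Commute.one_right _
    | of_succ j hj ih =>
      rw [hP j hj]
      exact (h.commute i j hij (by omega)).mul_right (ih (by omega))
  have := qNumber_smul_eq_neg_sum (K := K) (n := n)
    (X := fun j => q ^ j • τ (heckeAntisymmetrizer q r j * P j * T))
    (Z := fun j => qNumber q (j + 1) • τ (heckeAntisymmetrizer q r (j + 1) * P j * T))
    (by simp [heckeAntisymmetrizer, qNumber_one (q_sub_inv_ne_zero hq0 hq)]) ?_
  · simpa only [hPn, mul_one] using this
  · intro m hm
    have hA := (heckeAntisymmetrizer_spec hq0 hq h (m + 1) (by omega)).2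
    rw [← map_smul, ← smul_mul_assoc, ← smul_mul_assoc,
      pow_smul_heckeAntisymmetrizer hq0 hq h (by omega), add_mul, add_mul, map_add,
      smul_mul_assoc, smul_mul_assoc, map_smul, smul_mul_assoc, smul_mul_assoc, map_smul, hP m hm]
    congr 2
    have hAP : Commute (heckeAntisymmetrizer q r (m + 1)) (P (m + 1)) :=
      commute_heckeAntisymmetrizer q fun i hi => hcomm i (m + 1) (by omega) (by omega)
    have hAT : Commute (heckeAntisymmetrizer q r (m + 1)) T :=
      commute_heckeAntisymmetrizer q fun i hi => hT i (by omega)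
    have hAτ := heckeAntisymmetrizer_mem q (r := r) (cyclicSubalgebra τ) (k := m + 1)
      fun i hi => hτ i (by omega)
    set A := heckeAntisymmetrizer q r (m + 1)
    -- The right-hand A travels through P and T to the end, is cycled by τ to the front, and is
    -- absorbed there.
    calc τ (A * r m * A * P (m + 1) * T)
        = τ (A * r m * P (m + 1) * T * A) := by
          rw [mul_assoc _ A, hAP.eq, ← mul_assoc, mul_assoc _ A T, hAT.eq, ← mul_assoc]
      _ = τ (A * (A * r m * P (m + 1) * T)) := (hAτ _).symm
      _ = _ := by rw [← mul_assoc, ← mul_assoc, ← mul_assoc, hA, mul_assoc A]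

include hq0 hq in
/-- The Cayley-Hamilton-Newton identity for products of generators in decreasing order. -/
theorem hecke_newton_decreasing (h : IsHeckeFamily q r (n + 1)) (τ : M →ₗ[K] W) (T : M)
    (hT : ∀ i < n, Commute (r i) T) (hτ : ∀ i, i + 1 < n → ∀ y, τ (r i * y) = τ (y * r i))
    (P : ℕ → M) (hPn : P n = 1) (hP : ∀ j < n, P j = P (j + 1) * r j) :
    qNumber q (n + 1) • τ (heckeAntisymmetrizer q r (n + 1) * T) =
      -∑ j ∈ Finset.range (n + 1), (-1 : K) ^ (n + 1 - j) •
        q ^ j • τ (P j * heckeAntisymmetrizer q r j * T) := by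
  have hcomm : ∀ i j, i + 1 < j → j ≤ n → Commute (r i) (P j) := by
    intro i j hij hj
    induction hj using Nat.decreasingInduction with
    | self => rw [hPn]; exact Commute.one_right _
    | of_succ j hj ih =>
      rw [hP j hj]
      exact (ih (by omega)).mul_right (h.commute i j hij (by omega))
  have := qNumber_smul_eq_neg_sum (K := K) (n := n)
    (X := fun j => q ^ j • τ (P j * heckeAntisymmetrizer q r j * T))
    (Z := fun j => qNumber q (j + 1) • τ (P j * heckeAntisymmetrizer q r (j + 1) * T))
    (by simp [heckeAntisymmetrizer, qNumber_one (q_sub_inv_ne_zero hq0 hq)]) ?_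
  · simpa only [hPn, one_mul] using this
  · intro m hm
    have hA := (heckeAntisymmetrizer_spec hq0 hq h (m + 1) (by omega)).2
    rw [← map_smul, ← smul_mul_assoc, ← mul_smul_comm,
      pow_smul_heckeAntisymmetrizer hq0 hq h (by omega), mul_add, add_mul, map_add,
      mul_smul_comm, smul_mul_assoc, map_smul, mul_smul_comm, smul_mul_assoc, map_smul, hP m hm]
    congr 2
    have hAP : Commute (heckeAntisymmetrizer q r (m + 1)) (P (m + 1)) :=
      commute_heckeAntisymmetrizer q fun i hi => hcomm i (m + 1) (by omega) (by omega)
    have hAT : Commute (heckeAntisymmetrizer q r (m + 1)) T :=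
      commute_heckeAntisymmetrizer q fun i hi => hT i (by omega)
    have hAτ := heckeAntisymmetrizer_mem q (r := r) (cyclicSubalgebra τ) (k := m + 1)
      fun i hi => hτ i (by omega)
    set A := heckeAntisymmetrizer q r (m + 1)
    -- Here the left-hand A moves: out to the front through P, around by τ to the end, then back
    -- through T to merge with the other A.
    calc τ (P (m + 1) * (A * r m * A) * T)
        = τ (A * (P (m + 1) * r m * A * T)) := by
          rw [← mul_assoc, ← mul_assoc, ← hAP.eq]; simp only [mul_assoc]
      _ = τ (P (m + 1) * r m * A * T * A) := hAτ _
      _ = _ := by rw [mul_assoc _ T, ← hAT.eq, ← mul_assoc, mul_assoc _ A A, hA]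

end HeckeAlgebra

/-! ### Operators placed into selected tensor factors. -/

section Sites

theorem ite_zero_congr {A : Type*} [Zero A] {p p' : Prop} {_ : Decidable p} {_ : Decidable p'}
    {a b : A} (h : p ↔ p') (hab : a = b) : (if p then a else 0) = if p' then b else 0 := by
  subst hab
  exact ite_congr (propext h) (fun _ => rfl) fun _ => rfl

open Classical in
/-- A matrix acting on the copies labelled by `ι`, placed into the copies with labels `f i`. -/
noncomputable def onSites {ι κ n A : Type*} [Zero A] (f : ι → κ) (X : Matrix (ι → n) (ι → n) A) :
    Matrix (κ → n) (κ → n) A :=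
  Matrix.of fun x y => if ∀ b, b ∉ Set.range f → x b = y b then X (x ∘ f) (y ∘ f) else 0

theorem onSites_onSites {ι κ l n A : Type*} [Zero A] {g : κ → l} (hg : Function.Injective g)
    (f : ι → κ) (X : Matrix (ι → n) (ι → n) A) :
    onSites g (onSites f X) = onSites (g ∘ f) X := by
  ext x y
  have : (∀ b, b ∉ Set.range (g ∘ f) → x b = y b) ↔
      (∀ b, b ∉ Set.range g → x b = y b) ∧ ∀ b, b ∉ Set.range f → (x ∘ g) b = (y ∘ g) b := by
    constructor
    · refine fun h => ⟨fun b hb => h b ?_, fun b hb => h (g b) ?_⟩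
      · rintro ⟨c, rfl⟩; exact hb ⟨f c, rfl⟩
      · rintro ⟨c, hc⟩; exact hb ⟨c, hg hc⟩
    · rintro ⟨h1, h2⟩ b hb
      by_cases hbg : b ∈ Set.range g
      · obtain ⟨c, rfl⟩ := hbg
        exact h2 c fun ⟨d, hd⟩ => hb ⟨d, congrArg g hd⟩
      · exact h1 b hbg
  simp only [onSites, Matrix.of_apply]
  split_ifs with h1 h2 h3 h3
  · rfl
  · exact absurd (this.2 ⟨h1, h2⟩) h3
  · exact absurd (this.1 h3).2 h2
  · rfl
  · exact absurd (this.1 ‹_›).1 h1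
  · rfl

open Classical in
theorem onSites_mul_onSites_apply {ι ι' κ n A : Type*} [Fintype κ] [DecidableEq κ] [Fintype n]
    [DecidableEq n] [Semiring A]
    {f : ι → κ} {g : ι' → κ} (hfg : ∀ b, b ∈ Set.range f → b ∉ Set.range g)
    (X : Matrix (ι → n) (ι → n) A) (Y : Matrix (ι' → n) (ι' → n) A) (x y : κ → n) :
    (onSites f X * onSites g Y) x y =
      if ∀ b, b ∉ Set.range f → b ∉ Set.range g → x b = y b then
        X (x ∘ f) (y ∘ f) * Y (x ∘ g) (y ∘ g) else 0 := by
  rw [Matrix.mul_apply]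
  -- The only intermediate multi-index that contributes: the first factor has already changed its
  -- own copies to those of y, all others still agree with x.
  set w : κ → n := fun b => if b ∈ Set.range f then y b else x b with hw
  rw [Finset.sum_eq_single w]
  · have h1 : ∀ b, b ∉ Set.range f → x b = w b := fun b hb => by simp only [hw, if_neg hb]
    have h2 : w ∘ f = y ∘ f := by ext a; simp [hw]
    have h3 : w ∘ g = x ∘ g := by
      ext a
      have : g a ∉ Set.range f := fun h => hfg _ h ⟨a, rfl⟩
      simp only [hw, Function.comp, if_neg this]
    have h4 : (∀ b, b ∉ Set.range g → w b = y b) ↔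
        ∀ b, b ∉ Set.range f → b ∉ Set.range g → x b = y b := by
      refine forall_congr' fun b => ?_
      by_cases hb : b ∈ Set.range f
      · simp only [hw, if_pos hb, hb, not_true_eq_false, false_imp_iff, imp_true_iff]
      · simp only [hw, if_neg hb, hb, not_false_eq_true, true_imp_iff]
    simp only [onSites, Matrix.of_apply, if_pos h1, h2, h3, h4, mul_ite, mul_zero]
  · intro v _ hv
    simp only [onSites, Matrix.of_apply]
    split_ifs with h1 h2
    · refine absurd (funext fun b => ?_) hv
      by_cases hb : b ∈ Set.range f
      · simp only [hw, if_pos hb]; exact h2 b (hfg b hb)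
      · simp only [hw, if_neg hb]; exact (h1 b hb).symm
    all_goals simp
  · simp

open Classical in
-- Disjoint supports alone do not suffice over a noncommutative ring; in every use one of the two
-- matrices has scalar entries.
theorem commute_onSites {ι ι' κ n A : Type*} [Fintype κ] [DecidableEq κ] [Fintype n]
    [DecidableEq n] [Semiring A]
    {f : ι → κ} {g : ι' → κ} (hfg : ∀ b, b ∈ Set.range f → b ∉ Set.range g)
    {X : Matrix (ι → n) (ι → n) A} {Y : Matrix (ι' → n) (ι' → n) A}
    (hXY : ∀ a b c d, Commute (X a b) (Y c d)) : Commute (onSites f X) (onSites g Y) := by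
  ext x y
  rw [onSites_mul_onSites_apply hfg, onSites_mul_onSites_apply fun b hb hb' => hfg b hb' hb,
    (hXY _ _ _ _).eq]
  exact ite_zero_congr (forall_congr' fun b => forall_comm) rfl

theorem onSites_mul {ι κ n A : Type*} [Fintype ι] [DecidableEq ι] [Fintype κ] [DecidableEq κ]
    [Fintype n] [DecidableEq n] [Semiring A]
    {f : ι → κ} (hf : Function.Injective f) (X Y : Matrix (ι → n) (ι → n) A) :
    onSites f (X * Y) = onSites f X * onSites f Y := by
  ext x y
  rw [Matrix.mul_apply]
  have hoff : ∀ u : ι → n, ∀ b, b ∉ Set.range f → Function.extend f u x b = x b :=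
    fun u b hb => Function.extend_apply' _ _ _ hb
  have hon : ∀ u : ι → n, Function.extend f u x ∘ f = u := fun u => Function.extend_comp hf u x
  -- Nonzero terms come only from intermediate indices equal to x off the range of f, that is, from
  -- extensions by x of a multi-index u on ι.
  rw [← Fintype.sum_of_injective (fun u : ι → n => Function.extend f u x)
    (fun u v huv => by rw [← hon u, ← hon v]; exact congrArg (· ∘ f) huv)
    (fun u => onSites f X x (Function.extend f u x) * onSites f Y (Function.extend f u x) y) _ ?_
    fun _ => rfl]
  · have h1 : ∀ u : ι → n, ∀ b, b ∉ Set.range f → x b = Function.extend f u x b :=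
      fun u b hb => (hoff u b hb).symm
    have h2 : ∀ u : ι → n, (∀ b, b ∉ Set.range f → Function.extend f u x b = y b) ↔
        ∀ b, b ∉ Set.range f → x b = y b :=
      fun u => forall_congr' fun b => forall_congr' fun hb => by rw [hoff u b hb]
    simp only [onSites, Matrix.of_apply, if_pos (h1 _), h2, hon, mul_ite, mul_zero]
    split_ifs
    · rw [Matrix.mul_apply]
    · simp
  · intro w hw
    simp only [onSites, Matrix.of_apply]
    split_ifs with h1
    · refine absurd ⟨w ∘ f, funext fun b => ?_⟩ hw
      by_cases hb : b ∈ Set.range f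
      · obtain ⟨a, rfl⟩ := hb
        exact hf.extend_apply _ _ _
      · rw [← h1 b hb]; exact hoff _ b hb
    all_goals simp

theorem onSites_one {ι κ n A : Type*} [DecidableEq ι] [Fintype ι] [DecidableEq κ] [Fintype κ]
    [DecidableEq n] [Semiring A] (f : ι → κ) :
    onSites f (1 : Matrix (ι → n) (ι → n) A) = 1 := by
  ext x y
  simp only [onSites, Matrix.of_apply, Matrix.one_apply]
  rw [← ite_and]
  refine ite_zero_congr ⟨fun ⟨h1, h2⟩ => funext fun b => ?_, ?_⟩ rfl
  · by_cases hb : b ∈ Set.range f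
    · obtain ⟨a, rfl⟩ := hb
      exact congrFun h2 a
    · exact h1 b hb
  · rintro rfl
    exact ⟨fun _ _ => rfl, rfl⟩

/-- Placing matrices into copies with distinct labels, as a homomorphism of algebras. -/
noncomputable def onSitesHom (K : Type*) {ι κ n A : Type*} [Fintype ι] [DecidableEq ι] [Fintype κ]
    [DecidableEq κ] [Fintype n] [DecidableEq n] [CommSemiring K] [Semiring A] [Algebra K A]
    {f : ι → κ} (hf : Function.Injective f) :
    Matrix (ι → n) (ι → n) A →ₐ[K] Matrix (κ → n) (κ → n) A :=
  AlgHom.ofLinearMap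
    { toFun := onSites f
      map_add' := fun X Y => by
        ext x y
        simp only [onSites, Matrix.of_apply, Matrix.add_apply]
        split_ifs <;> simp
      map_smul' := fun c X => by
        ext x y
        simp only [onSites, Matrix.of_apply, Matrix.smul_apply, RingHom.id_apply]
        split_ifs <;> simp }
    (onSites_one f) (onSites_mul hf)

theorem onSitesHom_apply (K : Type*) {ι κ n A : Type*} [Fintype ι] [DecidableEq ι] [Fintype κ]
    [DecidableEq κ] [Fintype n] [DecidableEq n] [CommSemiring K] [Semiring A] [Algebra K A]
    {f : ι → κ} (hf : Function.Injective f) (X : Matrix (ι → n) (ι → n) A) :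
    onSitesHom K hf X = onSites f X := rfl

theorem onSites_map {ι κ n A B : Type*} [Zero A] [Zero B] (f : ι → κ)
    (X : Matrix (ι → n) (ι → n) A) (φ : A → B) (hφ : φ 0 = 0) :
    (onSites f X).map φ = onSites f (X.map φ) := by
  ext x y
  simp only [onSites, Matrix.of_apply, Matrix.map_apply]
  split_ifs <;> simp [hφ]

/-- The consecutive labels `i, …, i + m - 1`. -/
def window {k m : ℕ} (i : ℕ) (h : i + m ≤ k) : Fin m → Fin k := fun b => ⟨i + b, by omega⟩

theorem window_injective {k m : ℕ} (i : ℕ) (h : i + m ≤ k) : Function.Injective (window i h) := by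
  intro a b hab
  have := congrArg Fin.val hab
  simp only [window] at this
  exact Fin.ext (by omega)

theorem mem_range_window {k m i : ℕ} (h : i + m ≤ k) (b : Fin k) :
    b ∈ Set.range (window i h) ↔ i ≤ b ∧ (b : ℕ) < i + m := by
  constructor
  · rintro ⟨c, rfl⟩
    simp [window]
  · rintro ⟨h1, h2⟩
    exact ⟨⟨b - i, by omega⟩, Fin.ext (by simp [window]; omega)⟩

theorem window_comp_window {k l m i j : ℕ} (h : i + m ≤ k) (h' : j + k ≤ l) :
    window j h' ∘ window i h = window (j + i) (by omega) := by
  ext b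
  simp [window, add_assoc]

theorem onFirst_eq_onSites {N k : ℕ} {A : Type*} [Zero A] (X : MultiMatrix N k A) :
    onFirst X = onSites (window 0 (by omega)) X := by
  ext x y
  simp only [onFirst, onSites, Matrix.of_apply]
  refine ite_zero_congr ?_ ?_
  · simp only [mem_range_window]
    constructor
    · intro h b hb
      obtain rfl : b = Fin.last k := Fin.ext (by simp; omega)
      exact h
    · intro h
      exact h _ (by simp)
  · congr 1 <;> ext b <;> simp [window, Fin.init, Fin.castSucc, Fin.castAdd, Fin.castLE]

end Sites

/-! ### The Hecke algebra representation on tensor powers. -/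

section Generators

variable {N : ℕ} {A : Type*}

/-- The generator of the braid group number `i` (zero-based) in `k` copies of `V`. -/
noncomputable def braidGen [Zero A] (R : Matrix (Fin N × Fin N) (Fin N × Fin N) A) (k i : ℕ) :
    MultiMatrix N k A :=
  if h : i + 2 ≤ k then onSites (window i h) (onPair R 0 : MultiMatrix N 2 A) else 0

theorem braidGen_of_le [Zero A] (R : Matrix (Fin N × Fin N) (Fin N × Fin N) A) {k i : ℕ}
    (h : i + 2 ≤ k) :
    braidGen R k i = onSites (window i h) (onPair R 0 : MultiMatrix N 2 A) := dif_pos h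

theorem onSites_braidGen [Zero A] (R : Matrix (Fin N × Fin N) (Fin N × Fin N) A) {k l i j : ℕ}
    (h : j + k ≤ l) (hi : i + 2 ≤ k) :
    onSites (window j h) (braidGen R k i) = braidGen R l (j + i) := by
  rw [braidGen_of_le R hi, braidGen_of_le R (by omega), onSites_onSites (window_injective j h),
    window_comp_window]

theorem braidGen_eq_onPair [Zero A] (R : Matrix (Fin N × Fin N) (Fin N × Fin N) A) {k : ℕ}
    (a : Fin k) : braidGen R (k + 1) a = onPair R a := by
  rw [braidGen_of_le R (by omega)]
  ext x y
  have h0 : window (a : ℕ) (k := k + 1) (m := 2) (by omega) 0 = a.castSucc := rfl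
  have h1 : window (a : ℕ) (k := k + 1) (m := 2) (by omega) 1 = a.succ := rfl
  have e0 : (Fin.castSucc (0 : Fin 1)) = 0 := rfl
  have e1 : (Fin.succ (0 : Fin 1)) = 1 := rfl
  simp only [onSites, onPair, Matrix.of_apply, Function.comp, e0, e1, h0, h1]
  rw [if_pos (fun b hb hb' => by fin_cases b <;> simp at hb hb')]
  refine ite_zero_congr (forall_congr' fun b => ?_) rfl
  rw [mem_range_window, ← and_imp]
  refine imp_congr_left ?_
  simp only [ne_eq, Fin.ext_iff, Fin.val_castSucc, Fin.val_succ]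
  omega

theorem braidGen_map {B : Type*} [Zero A] [Zero B]
    (R : Matrix (Fin N × Fin N) (Fin N × Fin N) A) (φ : A → B) (hφ : φ 0 = 0) (k i : ℕ) :
    (braidGen R k i).map φ = braidGen (R.map φ) k i := by
  unfold braidGen
  split_ifs
  · rw [onSites_map _ _ _ hφ]
    congr 1
  · ext; simp [hφ]

variable {K : Type*} [Field K]

theorem onPair_zero_eq_reindex (R : Matrix (Fin N × Fin N) (Fin N × Fin N) K) :
    (onPair R 0 : MultiMatrix N 2 K) =
      Matrix.reindexAlgEquiv K K (finTwoArrowEquiv (Fin N)).symm R := by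
  ext x y
  rw [Matrix.coe_reindexAlgEquiv, Matrix.reindex_apply, Matrix.submatrix_apply, onPair,
    Matrix.of_apply, if_pos (fun b hb hb' => by fin_cases b <;> simp at hb hb')]
  rfl

theorem isHeckeFamily_braidGen {q : K}
    {R : Matrix (Fin N × Fin N) (Fin N × Fin N) K} (hYB : IsYangBaxter R) (hR : IsHecke q R)
    (k : ℕ) : IsHeckeFamily q (braidGen R k) k := by
  refine ⟨fun i hi => ?_, fun i hi => ?_, fun i j hij hj => ?_⟩
  · have hquad : (R - q • 1) * (R + q⁻¹ • 1) = 0 := by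
      obtain ⟨S, A, hS, hA, hSA, rfl⟩ := hR
      have hS' : S = 1 - A := eq_sub_of_add_eq hSA
      have h1 : q • S - q⁻¹ • A - q • 1 = -((q + q⁻¹) • A) := by
        rw [hS', smul_sub, add_smul]; abel
      have h2 : q • S - q⁻¹ • A + q⁻¹ • 1 = (q + q⁻¹) • S := by
        rw [← hSA, smul_add, add_smul]; abel
      rw [h1, h2, hS', neg_mul, smul_mul_smul_comm, mul_sub, mul_one, hA, sub_self, smul_zero,
        neg_zero]
    have := congrArg (onSitesHom K (window_injective i (m := 2) (k := k) (by omega)))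
      (congrArg (Matrix.reindexAlgEquiv K K (finTwoArrowEquiv (Fin N)).symm) hquad)
    simp only [map_mul, map_sub, map_add, map_smul, map_one, map_zero] at this
    rwa [← onPair_zero_eq_reindex, onSitesHom_apply, ← braidGen_of_le] at this
  · have := congrArg (onSitesHom K (window_injective i (m := 3) (k := k) (by omega))) hYB
    rw [← braidGen_eq_onPair R (0 : Fin 2), ← braidGen_eq_onPair R (1 : Fin 2)] at this
    simp only [map_mul, onSitesHom_apply] at this
    rw [onSites_braidGen _ _ (by simp), onSites_braidGen _ _ (by simp)] at this
    exact this
  · rw [braidGen_of_le R (by omega), braidGen_of_le R (by omega)]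
    refine commute_onSites (fun b => ?_) fun _ _ _ _ => Commute.all _ _
    rw [mem_range_window, mem_range_window]
    omega

/-- Embedding into one more copy is an algebra homomorphism that carries generators to generators,
so the recursion across growing tensor powers can be run inside one fixed algebra. -/
theorem antisymmetrizer_eq (q : K) (R : Matrix (Fin N × Fin N) (Fin N × Fin N) K) :
    ∀ k : ℕ, antisymmetrizer q R k = heckeAntisymmetrizer q (braidGen R k) k
  | 0 => rfl
  | 1 => rfl
  | k + 2 => by
    have : onFirst (antisymmetrizer q R (k + 1)) =
        heckeAntisymmetrizer q (braidGen R (k + 2)) (k + 1) := by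
      rw [antisymmetrizer_eq q R (k + 1), onFirst_eq_onSites,
        ← onSitesHom_apply K (window_injective _ _), map_heckeAntisymmetrizer]
      refine heckeAntisymmetrizer_congr q fun i hi => ?_
      rw [onSitesHom_apply, onSites_braidGen _ _ (by omega), zero_add]
    rw [antisymmetrizer, this, heckeAntisymmetrizer, ← braidGen_eq_onPair]
    rfl

theorem IsHeckeFamily.map {M M' : Type*} [Ring M] [Algebra K M] [Ring M'] [Algebra K M']
    (φ : M →ₐ[K] M') {q : K} {r : ℕ → M} {k : ℕ} (h : IsHeckeFamily q r k) :
    IsHeckeFamily q (fun i => φ (r i)) k := by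
  refine ⟨fun i hi => ?_, fun i hi => ?_, fun i j hij hj => (h.commute i j hij hj).map φ⟩
  · simpa only [map_mul, map_sub, map_add, map_smul, map_one, map_zero] using
      congrArg φ (h.quadratic i hi)
  · simpa only [map_mul] using congrArg φ (h.braid i hi)

theorem isHeckeFamily_braidGen_map [Ring A] [Algebra K A] {q : K}
    {R : Matrix (Fin N × Fin N) (Fin N × Fin N) K} (hYB : IsYangBaxter R) (hR : IsHecke q R)
    (k : ℕ) : IsHeckeFamily q (braidGen (R.map (algebraMap K A)) k) k := by
  have := (isHeckeFamily_braidGen hYB hR k).map (Algebra.ofId K A).mapMatrix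
  have e : (fun i => (Algebra.ofId K A).mapMatrix (braidGen R k i)) =
      braidGen (R.map (algebraMap K A)) k :=
    funext fun i => braidGen_map R (algebraMap K A) (map_zero _) k i
  rwa [e] at this

theorem antisymmetrizer_map [Ring A] [Algebra K A] (q : K)
    (R : Matrix (Fin N × Fin N) (Fin N × Fin N) K) (k : ℕ) :
    (antisymmetrizer q R k).map (algebraMap K A) =
      heckeAntisymmetrizer q (braidGen (R.map (algebraMap K A)) k) k := by
  have := map_heckeAntisymmetrizer (Algebra.ofId K A).mapMatrix q (braidGen R k) k
  rw [← antisymmetrizer_eq] at this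
  refine this.trans (congrArg (fun r => heckeAntisymmetrizer q r k) ?_)
  exact funext fun i => braidGen_map R (algebraMap K A) (map_zero _) k i

theorem onSites_antisymmetrizer_map [Ring A] [Algebra K A] (q : K)
    (R : Matrix (Fin N × Fin N) (Fin N × Fin N) K) {j k l : ℕ} (h : j + k ≤ l) :
    onSites (window j h) ((antisymmetrizer q R k).map (algebraMap K A)) =
      heckeAntisymmetrizer q (fun i => braidGen (R.map (algebraMap K A)) l (j + i)) k := by
  rw [antisymmetrizer_map, ← onSitesHom_apply K (window_injective _ _), map_heckeAntisymmetrizer]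
  exact heckeAntisymmetrizer_congr q fun i hi => onSites_braidGen _ _ (by omega)

/-- The product of the `m` consecutive generators with numbers `i, …, i + m - 1`. -/
noncomputable def braidWord [Semiring A] (R : Matrix (Fin N × Fin N) (Fin N × Fin N) A) (k i m : ℕ) :
    MultiMatrix N k A :=
  ((List.range' i m).map (braidGen R k)).prod

theorem prod_ofFn_onPair [Semiring A] (R : Matrix (Fin N × Fin N) (Fin N × Fin N) A) (m : ℕ) :
    (List.ofFn fun a : Fin m => (onPair R a : MultiMatrix N (m + 1) A)).prod =
      braidWord R (m + 1) 0 m := by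
  unfold braidWord
  congr 1
  refine List.ext_getElem (by simp) fun i h1 h2 => ?_
  rw [List.getElem_ofFn, ← braidGen_eq_onPair]
  simp

theorem onSites_braidWord [Semiring A] (R : Matrix (Fin N × Fin N) (Fin N × Fin N) A)
    {k l i j m : ℕ} (h : j + k ≤ l) (hi : i + m + 1 ≤ k) :
    onSites (window j h) (braidWord R k i m) = braidWord R l (j + i) m := by
  rw [braidWord, ← onSitesHom_apply ℕ (window_injective j h), map_list_prod, List.map_map,
    braidWord]
  congr 1
  refine List.ext_getElem (by simp) fun a h1 h2 => ?_
  simp only [List.length_map, List.length_range'] at h1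
  simp only [List.getElem_map, List.getElem_range', Function.comp, onSitesHom_apply]
  rw [onSites_braidGen _ _ (by omega), add_assoc]

end Generators

/-! ### Cyclicity and factorization of partial traces. -/

section PartialTraces

variable {N k : ℕ} {A : Type*}

/-- The partial trace over all copies of `V` but the last one, as a linear map. -/
def traceAllButLastHom (K : Type*) (N k : ℕ) (A : Type*) [CommSemiring K] [Semiring A]
    [Algebra K A] : MultiMatrix N (k + 1) A →ₗ[K] Matrix (Fin N) (Fin N) A where
  toFun := traceAllButLast
  map_add' X Y := by
    ext; simp [traceAllButLast, Finset.sum_add_distrib]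
  map_smul' c X := by
    ext; simp [traceAllButLast, Finset.smul_sum]

/-- The partial trace over all copies of `V` but the first one, as a linear map. -/
def traceAllButFirstHom (K : Type*) (N k : ℕ) (A : Type*) [CommSemiring K] [Semiring A]
    [Algebra K A] : MultiMatrix N (k + 1) A →ₗ[K] Matrix (Fin N) (Fin N) A where
  toFun := traceAllButFirst
  map_add' X Y := by
    ext; simp [traceAllButFirst, Finset.sum_add_distrib]
  map_smul' c X := by
    ext; simp [traceAllButFirst, Finset.smul_sum]

/-- A partial trace is cyclic with respect to matrices with central entries which act in the traced
factor only. -/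
theorem partialTrace_mul_comm {n p m : Type*} [Fintype n] [Fintype p] [Fintype m] [DecidableEq n]
    [Semiring A] (E : n × p ≃ m) (X : Matrix p p A) (hX : ∀ a b c, Commute (X a b) c)
    (X' Y : Matrix m m A)
    (hX' : ∀ i j z w, X' (E (i, z)) (E (j, w)) = if i = j then X z w else 0) (i j : n) :
    ∑ z, (X' * Y) (E (i, z)) (E (j, z)) = ∑ z, (Y * X') (E (i, z)) (E (j, z)) := by
  simp only [Matrix.mul_apply, ← E.sum_comp, Fintype.sum_prod_type, hX', ite_mul, mul_ite,
    zero_mul, mul_zero]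
  have h1 : ∀ z, (∑ a, ∑ w, if i = a then X z w * Y (E (a, w)) (E (j, z)) else 0) =
      ∑ w, X z w * Y (E (i, w)) (E (j, z)) := fun z => by
    rw [Finset.sum_comm]; simp
  have h2 : ∀ z, (∑ a, ∑ w, if a = j then Y (E (i, z)) (E (a, w)) * X w z else 0) =
      ∑ w, Y (E (i, z)) (E (j, w)) * X w z := fun z => by
    rw [Finset.sum_comm]; simp
  simp only [h1, h2]
  rw [Finset.sum_comm]
  simp only [(hX _ _ _).eq]

theorem traceAllButLast_mul_comm [Semiring A] (X : MultiMatrix N k A)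
    (hX : ∀ a b c, Commute (X a b) c) (Y : MultiMatrix N (k + 1) A) :
    traceAllButLast (onSites (window 0 (by omega)) X * Y) =
      traceAllButLast (Y * onSites (window 0 (by omega)) X) := by
  ext i j
  refine partialTrace_mul_comm (Fin.snocEquiv fun _ => Fin N) X hX _ Y (fun i j z w => ?_) i j
  rw [← onFirst_eq_onSites]
  simp [onFirst, Fin.snocEquiv]

theorem traceAllButFirst_mul_comm [Semiring A] (X : MultiMatrix N k A)
    (hX : ∀ a b c, Commute (X a b) c) (Y : MultiMatrix N (k + 1) A) :
    traceAllButFirst (onSites (window 1 (by omega)) X * Y) =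
      traceAllButFirst (Y * onSites (window 1 (by omega)) X) := by
  ext i j
  refine partialTrace_mul_comm (Fin.consEquiv fun _ => Fin N) X hX _ Y (fun i j z w => ?_) i j
  have hw : window 1 (k := k + 1) (m := k) (by omega) = Fin.succ := by
    ext b; simp [window, add_comm]
  rw [hw, onSites, Matrix.of_apply]
  refine ite_zero_congr ?_ rfl
  simp [Fin.consEquiv]

/-- The fully traced block stands to the left, so its entries multiply from the left; the order
matters as entries need not commute. -/
theorem traceAllButLast_mul [Semiring A] {j m : ℕ} (X : MultiMatrix N j A)
    (Y : MultiMatrix N (m + 1) A) :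
    traceAllButLast (onSites (window 0 (by omega)) X * onSites (window j (by omega)) Y :
      MultiMatrix N (j + m + 1) A) = leftMul X.trace (traceAllButLast Y) := by
  ext a b
  have h0 : window 0 (k := j + m + 1) (m := j) (by omega) = Fin.castAdd (m + 1) := by
    ext b; simp [window]
  have h1 : window j (k := j + m + 1) (m := m + 1) (by omega) = Fin.natAdd j := by
    ext b; simp [window]
  have e0 : ∀ (u : Fin j → Fin N) (v : Fin m → Fin N) c,
      (Fin.snoc (α := fun _ => Fin N) (Fin.append u v) c : Fin (j + m + 1) → Fin N) ∘
        (Fin.castAdd (m + 1) : Fin j → Fin (j + m + 1)) = u := fun u v c => by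
    rw [← Fin.append_snoc]; ext d; simp
  have e1 : ∀ (u : Fin j → Fin N) (v : Fin m → Fin N) c,
      (Fin.snoc (α := fun _ => Fin N) (Fin.append u v) c : Fin (j + m + 1) → Fin N) ∘
        (Fin.natAdd j : Fin (m + 1) → Fin (j + m + 1)) = Fin.snoc (α := fun _ => Fin N) v c :=
    fun u v c => by
      rw [← Fin.append_snoc]; ext d; simp
  simp only [traceAllButLast, leftMul, Matrix.of_apply, Matrix.trace, Matrix.diag]
  rw [← (Fin.appendEquiv j m).sum_comp, Fintype.sum_prod_type, Finset.sum_mul_sum]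
  refine Finset.sum_congr rfl fun u _ => Finset.sum_congr rfl fun v _ => ?_
  rw [onSites_mul_onSites_apply, if_pos, h0, h1]
  · simp only [Fin.appendEquiv, Equiv.coe_fn_mk, e0, e1]
  · intro c hc hc'
    rw [mem_range_window] at hc hc'
    omega
  · intro c
    rw [mem_range_window, mem_range_window]
    omega

theorem traceAllButFirst_mul [Semiring A] {j m : ℕ} (X : MultiMatrix N j A)
    (Y : MultiMatrix N (m + 1) A) :
    traceAllButFirst (onSites (window 0 (by omega)) Y * onSites (window (m + 1) (by omega)) X :
      MultiMatrix N (m + j + 1) A) = rightMul (traceAllButFirst Y) X.trace := by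
  ext a b
  have e0 : ∀ (u : Fin m → Fin N) (v : Fin j → Fin N) c,
      (Fin.cons (α := fun _ => Fin N) c (Fin.append u v) : Fin (m + j + 1) → Fin N) ∘
        window 0 (m := m + 1) (by omega) = Fin.cons (α := fun _ => Fin N) c u := fun u v c => by
    funext d
    refine Fin.cases ?_ (fun d => ?_) d
    · rfl
    · have : window 0 (k := m + j + 1) (m := m + 1) (by omega) d.succ =
          (Fin.castAdd j d).succ := by ext; simp [window]
      rw [Function.comp, this, Fin.cons_succ, Fin.cons_succ, Fin.append_left]
  have e1 : ∀ (u : Fin m → Fin N) (v : Fin j → Fin N) c,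
      (Fin.cons (α := fun _ => Fin N) c (Fin.append u v) : Fin (m + j + 1) → Fin N) ∘
        window (m + 1) (m := j) (by omega) = v := fun u v c => by
    funext d
    have : window (m + 1) (k := m + j + 1) (m := j) (by omega) d = (Fin.natAdd m d).succ := by
      ext; simp [window]; omega
    rw [Function.comp, this, Fin.cons_succ, Fin.append_right]
  simp only [traceAllButFirst, rightMul, Matrix.of_apply, Matrix.trace, Matrix.diag]
  rw [← (Fin.appendEquiv m j).sum_comp, Fintype.sum_prod_type, Finset.sum_mul_sum]
  refine Finset.sum_congr rfl fun u _ => Finset.sum_congr rfl fun v _ => ?_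
  rw [onSites_mul_onSites_apply, if_pos]
  · simp only [Fin.appendEquiv, Equiv.coe_fn_mk, e0, e1]
  · intro c hc hc'
    rw [mem_range_window] at hc hc'
    omega
  · intro c
    rw [mem_range_window, mem_range_window]
    omega

end PartialTraces

/-! ### RTT relations and the Cayley–Hamilton–Newton identities. -/

section RTT

variable {N : ℕ} {K : Type*} [Field K] (R : Matrix (Fin N × Fin N) (Fin N × Fin N) K)

theorem onSites_onCopy {A : Type*} [Zero A] {ι κ : ℕ} {f : Fin ι → Fin κ}
    (hf : Function.Injective f) (T : Matrix (Fin N) (Fin N) A) (a : Fin ι) :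
    onSites f (onCopy T a) = onCopy T (f a) := by
  ext x y
  simp only [onSites, onCopy, Matrix.of_apply]
  have : (∀ b, b ≠ f a → x b = y b) ↔
      (∀ b, b ∉ Set.range f → x b = y b) ∧ ∀ b, b ≠ a → (x ∘ f) b = (y ∘ f) b := by
    constructor
    · refine fun h => ⟨fun b hb => h b ?_, fun b hb => h _ (hf.ne hb)⟩
      rintro rfl; exact hb ⟨a, rfl⟩
    · rintro ⟨h1, h2⟩ b hb
      by_cases hbf : b ∈ Set.range f
      · obtain ⟨c, rfl⟩ := hbf
        exact h2 c fun h => hb (h ▸ rfl)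
      · exact h1 b hbf
  split_ifs with h1 h2 h3 h3
  · rfl
  · exact absurd (this.2 ⟨h1, h2⟩) h3
  · exact absurd (this.1 h3).2 h2
  · rfl
  · exact absurd (this.1 ‹_›).1 h1
  · rfl

theorem prodT_eq_mul {j m n : ℕ} (h : j + m = n) :
    prodT R n = onSites (window 0 (by omega)) (prodT R j) *
      onSites (window j (by omega)) (prodT R m) := by
  subst h
  rw [prodT, List.ofFn_add, List.prod_append]
  congr 1
  · rw [prodT, ← onSitesHom_apply K (window_injective _ _), map_list_prod, List.map_ofFn]
    congr 2
    funext a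
    rw [Function.comp, onSitesHom_apply, onSites_onCopy (window_injective _ _)]
    congr 1
    ext; simp [window]
  · rw [prodT, ← onSitesHom_apply K (window_injective _ _), map_list_prod, List.map_ofFn]
    congr 2
    funext a
    rw [Function.comp, onSitesHom_apply, onSites_onCopy (window_injective _ _)]
    congr 1

theorem onPair_map {A : Type*} [Ring A] [Algebra K A] :
    (onPair (R.map (algebraMap K A)) 0 : MultiMatrix N 2 A) =
      (onPair R 0 : MultiMatrix N 2 K).map (algebraMap K A) := by
  ext x y
  simp only [onPair, Matrix.of_apply, Matrix.map_apply]
  split_ifs <;> simp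

theorem map_algebraMap_commute {A m n : Type*} [Ring A] [Algebra K A] (X : Matrix m n K) (x : m)
    (y : n) (c : A) : Commute (X.map (algebraMap K A) x y) c :=
  Algebra.commute_algebraMap_left (X x y) c

theorem onPair_mul_prodT_two :
    onPair (R.map (algebraMap K (RTTAlgebra R))) 0 * prodT R 2 =
      prodT R 2 * onPair (R.map (algebraMap K (RTTAlgebra R))) 0 := by
  have hT : ∀ a : Fin 2, (onCopy (rttT R) a : MultiMatrix N 2 (RTTAlgebra R)) =
      (RingQuot.mkAlgHom K (RTTRel R)).mapMatrix (onCopy (freeT N K) a) := fun a => by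
    ext x y
    simp only [onCopy, rttT, AlgHom.mapMatrix_apply, Matrix.of_apply, Matrix.map_apply]
    split_ifs <;> simp
  have hR : (onPair (R.map (algebraMap K (RTTAlgebra R))) 0 : MultiMatrix N 2 (RTTAlgebra R)) =
      (RingQuot.mkAlgHom K (RTTRel R)).mapMatrix
        (onPair (R.map (algebraMap K (FreeAlgebra K (Fin N × Fin N)))) 0) := by
    rw [onPair_map, onPair_map]
    ext x y
    simp
  have hprod : prodT R 2 = onCopy (rttT R) 0 * onCopy (rttT R) 1 := by
    simp [prodT, List.ofFn_succ]
  rw [hprod, hT, hT, hR, ← map_mul, ← map_mul, ← map_mul, ← mul_assoc]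
  ext x y
  exact RingQuot.mkAlgHom_rel K (RTTRel.entry x y)

/-- Split T_1⋯T_n into the blocks before, on and after the pair of copies where the generator acts.
The outer blocks commute with its scalar entries, and the middle one is the defining relation. -/
theorem commute_braidGen_prodT {n i : ℕ} (hi : i + 2 ≤ n) :
    Commute (braidGen (R.map (algebraMap K (RTTAlgebra R))) n i) (prodT R n) := by
  rw [braidGen_of_le _ hi, prodT_eq_mul R (show i + (n - i) = n by omega),
    prodT_eq_mul R (show 2 + (n - i - 2) = n - i by omega),
    onSites_mul (window_injective _ _), onSites_onSites (window_injective _ _),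
    onSites_onSites (window_injective _ _), window_comp_window, window_comp_window]
  have hc : ∀ a b (c : RTTAlgebra R), Commute
      ((onPair (R.map (algebraMap K (RTTAlgebra R))) 0 : MultiMatrix N 2 _) a b) c := by
    intro a b c
    rw [onPair_map]
    exact map_algebraMap_commute _ _ _ _
  refine Commute.mul_right ?_ (Commute.mul_right ?_ ?_)
  · refine commute_onSites (fun b => ?_) fun _ _ _ _ => hc _ _ _
    rw [mem_range_window, mem_range_window]
    omega
  · have := congrArg (onSites (window i hi)) (onPair_mul_prodT_two R)
    rwa [onSites_mul (window_injective _ _), onSites_mul (window_injective _ _)] at this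
  · refine commute_onSites (fun b => ?_) fun _ _ _ _ => hc _ _ _
    rw [mem_range_window, mem_range_window]
    omega

theorem braidGen_map_commute {A : Type*} [Ring A] [Algebra K A] (k i : ℕ) (x y : Fin k → Fin N)
    (c : A) : Commute (braidGen (R.map (algebraMap K A)) k i x y) c := by
  rw [← braidGen_map _ _ (map_zero _)]
  exact map_algebraMap_commute _ _ _ _

theorem braidWord_map_commute {A : Type*} [Ring A] [Algebra K A] (k i m : ℕ)
    (x y : Fin k → Fin N) (c : A) :
    Commute (braidWord (R.map (algebraMap K A)) k i m x y) c := by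
  have : braidWord (R.map (algebraMap K A)) k i m =
      (Algebra.ofId K A).mapMatrix (braidWord R k i m) := by
    rw [braidWord, braidWord, map_list_prod, List.map_map]
    congr 2
    funext a
    exact (braidGen_map R (algebraMap K A) (map_zero _) k a).symm
  rw [this]
  exact map_algebraMap_commute _ _ _ _

variable (q : K)

theorem leftMul_sigma_powLower (j m : ℕ) :
    leftMul (sigma q R j) (powLower R (m + 1)) =
      q ^ j • traceAllButLastHom K N (j + m) (RTTAlgebra R)
        (heckeAntisymmetrizer q (braidGen (R.map (algebraMap K (RTTAlgebra R))) (j + m + 1)) j *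
          braidWord (R.map (algebraMap K (RTTAlgebra R))) (j + m + 1) j m *
          prodT R (j + m + 1)) := by
  have hs : leftMul (sigma q R j) (powLower R (m + 1)) =
      q ^ j • leftMul (antisymProd q R j).trace (traceAllButLast (braidProd R m)) := by
    ext; simp [leftMul, sigma, powLower]
  have hA := onSites_antisymmetrizer_map (A := RTTAlgebra R) q R
    (show 0 + j ≤ j + m + 1 by omega)
  have hW := onSites_braidWord (R.map (algebraMap K (RTTAlgebra R)))
    (show j + (m + 1) ≤ j + m + 1 by omega) (i := 0) (m := m) (by omega)
  simp only [zero_add, add_zero] at hA hW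
  -- The T's of the first block may cross the braid word of the second, whose entries are scalars;
  -- this collects all T's on the right as T_1⋯T_n.
  have hcomm : Commute (onSites (window 0 (show 0 + j ≤ j + m + 1 by omega)) (prodT R j))
      (onSites (window j (show j + (m + 1) ≤ j + m + 1 by omega))
        (braidWord (R.map (algebraMap K (RTTAlgebra R))) (m + 1) 0 m)) := by
    refine commute_onSites (fun b => ?_) fun _ _ _ _ => (braidWord_map_commute R _ _ _ _ _ _).symm
    rw [mem_range_window, mem_range_window]
    omega
  rw [hs, ← traceAllButLast_mul, antisymProd, braidProd, prod_ofFn_onPair,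
    onSites_mul (window_injective _ _), onSites_mul (window_injective _ _),
    hcomm.mul_mul_mul_comm, ← prodT_eq_mul R (show j + (m + 1) = j + m + 1 by omega), hA, hW]
  rfl

theorem rightMul_powUpper_sigma (hq0 : q ≠ 0) (hq : ∀ m : ℕ, 0 < m → q ^ m ≠ 1)
    (hYB : IsYangBaxter R) (hHecke : IsHecke q R) (j m : ℕ) :
    rightMul (powUpper R (m + 1)) (sigma q R j) =
      q ^ j • traceAllButFirstHom K N (m + j) (RTTAlgebra R)
        (braidWord (R.map (algebraMap K (RTTAlgebra R))) (m + j + 1) 0 m *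
          heckeAntisymmetrizer q (fun i =>
            braidGen (R.map (algebraMap K (RTTAlgebra R))) (m + j + 1) (m + j - 1 - i)) j *
          prodT R (m + j + 1)) := by
  have hs : rightMul (powUpper R (m + 1)) (sigma q R j) =
      q ^ j • rightMul (traceAllButFirst (braidProd R m)) (antisymProd q R j).trace := by
    ext; simp [rightMul, sigma, powUpper]
  have hA := onSites_antisymmetrizer_map (A := RTTAlgebra R) q R
    (show (m + 1) + j ≤ m + j + 1 by omega)
  have hW := onSites_braidWord (R.map (algebraMap K (RTTAlgebra R)))
    (show 0 + (m + 1) ≤ m + j + 1 by omega) (i := 0) (m := m) (by omega)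
  -- The antisymmetrizer on the last j copies is rewritten with its generators numbered from the
  -- right end, as the reversed family in `hecke_newton_decreasing` requires.
  rw [← heckeAntisymmetrizer_reverse hq0 hq
    ((isHeckeFamily_braidGen_map hYB hHecke (m + j + 1)).shift (by omega)),
    heckeAntisymmetrizer_congr (s := fun i =>
      braidGen (R.map (algebraMap K (RTTAlgebra R))) (m + j + 1) (m + j - 1 - i)) q
      fun i hi => congrArg _ (by omega)] at hA
  have hcomm : Commute (onSites (window 0 (show 0 + (m + 1) ≤ m + j + 1 by omega))
        (prodT R (m + 1)))
      (onSites (window (m + 1) (show (m + 1) + j ≤ m + j + 1 by omega))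
        ((antisymmetrizer q R j).map (algebraMap K (RTTAlgebra R)))) := by
    refine commute_onSites (fun b => ?_) fun _ _ _ _ => (map_algebraMap_commute _ _ _ _).symm
    rw [mem_range_window, mem_range_window]
    omega
  rw [hs, ← traceAllButFirst_mul, antisymProd, braidProd, prod_ofFn_onPair,
    onSites_mul (window_injective _ _), onSites_mul (window_injective _ _),
    hcomm.mul_mul_mul_comm, ← prodT_eq_mul R (show (m + 1) + j = m + j + 1 by omega), hA, hW]
  rfl

variable {q R}

theorem cayleyHamiltonNewton_lower (hq0 : q ≠ 0) (hq : ∀ m : ℕ, 0 < m → q ^ m ≠ 1)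
    (hYB : IsYangBaxter R) (hHecke : IsHecke q R) (n : ℕ) :
    qNumber q (n + 1) • wedgeLower q R (n + 1) =
      -∑ j ∈ Finset.range (n + 1), (-1 : K) ^ (n + 1 - j) •
        leftMul (sigma q R j) (powLower R (n + 1 - j)) := by
  set R' := R.map (algebraMap K (RTTAlgebra R)) with hR'
  have := hecke_newton_increasing hq0 hq (isHeckeFamily_braidGen_map hYB hHecke (n + 1))
    (traceAllButLastHom K N n (RTTAlgebra R)) (prodT R (n + 1))
    (fun i hi => commute_braidGen_prodT R (by omega)) (fun i hi Y => ?_)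
    (fun j => braidWord R' (n + 1) j (n - j)) (by simp [braidWord]) (fun j hj => ?_)
  · rw [← antisymmetrizer_map] at this
    refine Eq.trans this (congrArg _ (Finset.sum_congr rfl fun j hj => ?_))
    obtain ⟨m, rfl⟩ : ∃ m, n = j + m := ⟨n - j, by have := Finset.mem_range.1 hj; omega⟩
    rw [show j + m + 1 - j = m + 1 by omega, leftMul_sigma_powLower,
      show j + m - j = m by omega]
  · rw [← zero_add i, ← onSites_braidGen R' (show 0 + n ≤ n + 1 by omega) (by omega)]
    exact traceAllButLast_mul_comm _ (fun _ _ _ => braidGen_map_commute R _ _ _ _ _) Y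
  · rw [braidWord, braidWord, show n - j = n - (j + 1) + 1 by omega, List.range'_succ,
      List.map_cons, List.prod_cons]

theorem cayleyHamiltonNewton_upper (hq0 : q ≠ 0) (hq : ∀ m : ℕ, 0 < m → q ^ m ≠ 1)
    (hYB : IsYangBaxter R) (hHecke : IsHecke q R) (n : ℕ) :
    qNumber q (n + 1) • wedgeUpper q R (n + 1) =
      -∑ j ∈ Finset.range (n + 1), (-1 : K) ^ (n + 1 - j) •
        rightMul (powUpper R (n + 1 - j)) (sigma q R j) := by
  set R' := R.map (algebraMap K (RTTAlgebra R)) with hR'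
  have hH := isHeckeFamily_braidGen_map (A := RTTAlgebra R) hYB hHecke (n + 1)
  have := hecke_newton_decreasing hq0 hq hH.reverse
    (traceAllButFirstHom K N n (RTTAlgebra R)) (prodT R (n + 1))
    (fun i hi => commute_braidGen_prodT R (by omega)) (fun i hi Y => ?_)
    (fun j => braidWord R' (n + 1) 0 (n - j)) (by simp [braidWord]) (fun j hj => ?_)
  · rw [heckeAntisymmetrizer_reverse hq0 hq hH, ← antisymmetrizer_map] at this
    refine Eq.trans this (congrArg _ (Finset.sum_congr rfl fun j hj => ?_))
    obtain ⟨m, rfl⟩ : ∃ m, n = m + j := ⟨n - j, by have := Finset.mem_range.1 hj; omega⟩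
    rw [show m + j + 1 - j = m + 1 by omega, rightMul_powUpper_sigma R q hq0 hq hYB hHecke,
      show m + j - j = m by omega]
    rfl
  -- The reversed generators with i + 1 < n avoid the first copy, so they act only in traced copies.
  · rw [show n + 1 - 2 - i = 1 + (n - 2 - i) by omega,
      ← onSites_braidGen R' (show 1 + n ≤ n + 1 by omega) (by omega)]
    exact traceAllButFirst_mul_comm _ (fun _ _ _ => braidGen_map_commute R _ _ _ _ _) Y
  · rw [braidWord, braidWord, show n - j = n - (j + 1) + 1 by omega, List.range'_1_concat,
      List.map_append, List.prod_append, List.map_singleton, List.prod_singleton]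
    congr 2
    omega

end RTT

/-! ### Vanishing of the (N+1)-st Drinfeld–Jimbo antisymmetrizer. -/

section DrinfeldJimbo

variable {N : ℕ} {K : Type*} [Field K] {q : K}

theorem onPair_drinfeldJimbo_apply {k : ℕ} (a : Fin k) (x w : Fin (k + 1) → Fin N) :
    onPair (drinfeldJimbo N q) a x w =
      (if w = x ∘ Equiv.swap a.castSucc a.succ then
        (if x a.castSucc = x a.succ then q else 1) else 0) +
      if w = x then (q - q⁻¹) * (if x a.castSucc < x a.succ then 1 else 0) else 0 := by
  have hne : a.castSucc ≠ a.succ := a.castSucc_lt_succ.ne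
  have h1 : w = x ∘ Equiv.swap a.castSucc a.succ ↔
      (∀ b, b ≠ a.castSucc → b ≠ a.succ → x b = w b) ∧
        x a.castSucc = w a.succ ∧ x a.succ = w a.castSucc := by
    constructor
    · rintro rfl
      refine ⟨fun b hb hb' => ?_, by simp, by simp⟩
      rw [Function.comp, Equiv.swap_apply_of_ne_of_ne hb hb']
    · rintro ⟨h, h', h''⟩
      funext b
      by_cases hb : b = a.castSucc
      · simp [hb, h'']
      by_cases hb' : b = a.succ
      · simp [hb', h']
      rw [Function.comp, Equiv.swap_apply_of_ne_of_ne hb hb', h b hb hb']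
  have h2 : w = x ↔ (∀ b, b ≠ a.castSucc → b ≠ a.succ → x b = w b) ∧
        x a.castSucc = w a.castSucc ∧ x a.succ = w a.succ := by
    constructor
    · rintro rfl; exact ⟨fun _ _ _ => rfl, rfl, rfl⟩
    · rintro ⟨h, h', h''⟩
      funext b
      by_cases hb : b = a.castSucc
      · rw [hb, h']
      by_cases hb' : b = a.succ
      · rw [hb', h'']
      exact (h b hb hb').symm
  simp only [onPair, drinfeldJimbo, Matrix.of_apply, h1, h2]
  by_cases hoff : ∀ b, b ≠ a.castSucc → b ≠ a.succ → x b = w b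
  · simp only [eq_true hoff, if_true, true_and]
    by_cases hx : x a.castSucc = w a.castSucc ∧ x a.succ = w a.succ
    · simp [hx.1, hx.2]
    · simp [hx]
  · simp [hoff]

theorem onPair_drinfeldJimbo_mulVec {k : ℕ} (a : Fin k) (v : (Fin (k + 1) → Fin N) → K)
    (x : Fin (k + 1) → Fin N) :
    (onPair (drinfeldJimbo N q) a).mulVec v x =
      (if x a.castSucc = x a.succ then q else 1) * v (x ∘ Equiv.swap a.castSucc a.succ) +
      (q - q⁻¹) * (if x a.castSucc < x a.succ then 1 else 0) * v x := by
  simp only [Matrix.mulVec, dotProduct, onPair_drinfeldJimbo_apply, add_mul,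
    Finset.sum_add_distrib, ite_mul, zero_mul, Finset.sum_ite_eq', Finset.mem_univ, if_true]

/-- A vector antisymmetric with respect to the Drinfeld-Jimbo matrices has vanishing coordinates
at multi-indices with a repetition. -/
theorem eq_zero_of_drinfeldJimbo_antisymmetric (hq0 : q ≠ 0) (hq : ∀ m : ℕ, 0 < m → q ^ m ≠ 1)
    {k : ℕ} {v : (Fin (k + 1) → Fin N) → K}
    (hv : ∀ a : Fin k, (onPair (drinfeldJimbo N q) a).mulVec v = -q⁻¹ • v) (d : ℕ) :
    ∀ (x : Fin (k + 1) → Fin N) (i j : Fin (k + 1)), (j : ℕ) = i + d + 1 → x i = x j →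
      v x = 0 := by
  -- Otherwise q² = -1 and q⁴ = 1.
  have hq' : q + q⁻¹ ≠ 0 := fun h => hq 4 (by norm_num) (by
    field_simp at h
    linear_combination (q ^ 2 - 1) * h)
  have key : ∀ (a : Fin k) x, (if x a.castSucc = x a.succ then q else 1) *
      v (x ∘ Equiv.swap a.castSucc a.succ) +
      (q - q⁻¹) * (if x a.castSucc < x a.succ then 1 else 0) * v x = -q⁻¹ * v x := fun a x => by
    rw [← onPair_drinfeldJimbo_mulVec, hv a]; rfl
  induction d with
  -- Equal neighbours: the swap fixes x, and the eigenvector equation becomes (q + q⁻¹) v x = 0.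
  | zero =>
    intro x i j hij hx
    obtain ⟨a, rfl, rfl⟩ : ∃ a : Fin k, i = a.castSucc ∧ j = a.succ :=
      ⟨⟨i, by omega⟩, rfl, Fin.ext hij⟩
    have h := key a x
    have hs : x ∘ Equiv.swap a.castSucc a.succ = x := by
      funext b
      rw [Function.comp, Equiv.swap_apply_def]
      split_ifs with h1 h2
      · rw [h1, hx]
      · rw [h2, hx]
      · rfl
    rw [hs, if_pos hx, if_neg hx.not_lt] at h
    refine (mul_eq_zero.1 (?_ : (q + q⁻¹) * v x = 0)).resolve_left hq'
    linear_combination h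
  | succ d ih =>
    intro x i j hij hx
    obtain ⟨a, ha, rfl⟩ : ∃ a : Fin k, (a : ℕ) = i + d + 1 ∧ j = a.succ :=
      ⟨⟨i + d + 1, by omega⟩, rfl, Fin.ext (by rw [hij, Fin.val_succ]; rfl)⟩
    have hi : i ≠ a.castSucc := fun h => by
      have := congrArg Fin.val h; simp [ha] at this; omega
    have hi' : i ≠ a.succ := fun h => by
      have := congrArg Fin.val h; simp [ha] at this; omega
    -- Swapping the right-hand repeated index one place left shortens the distance, so the induction
    -- hypothesis removes the swapped term; what remains is q or q⁻¹ times v x.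
    have hs : v (x ∘ Equiv.swap a.castSucc a.succ) = 0 := by
      refine ih _ i a.castSucc (by simp [ha]) ?_
      rw [Function.comp, Function.comp, Equiv.swap_apply_of_ne_of_ne hi hi',
        Equiv.swap_apply_left, hx]
    have h := key a x
    rw [hs, mul_zero, zero_add] at h
    split_ifs at h
    · refine (mul_eq_zero.1 (?_ : q * v x = 0)).resolve_left hq0
      linear_combination h
    · refine (mul_eq_zero.1 (?_ : q⁻¹ * v x = 0)).resolve_left (inv_ne_zero hq0)
      linear_combination h

theorem antisymmetrizer_drinfeldJimbo_eq_zero (hq0 : q ≠ 0) (hq : ∀ m : ℕ, 0 < m → q ^ m ≠ 1)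
    (hYB : IsYangBaxter (drinfeldJimbo N q)) (hHecke : IsHecke q (drinfeldJimbo N q)) :
    antisymmetrizer q (drinfeldJimbo N q) (N + 1) = 0 := by
  have hspec := (heckeAntisymmetrizer_spec hq0 hq
    (isHeckeFamily_braidGen hYB hHecke (N + 1)) (N + 1) le_rfl).1
  rw [← antisymmetrizer_eq] at hspec
  ext x y
  -- Each column of the antisymmetrizer is an eigenvector of every generator with eigenvalue -q⁻¹.
  set v : (Fin (N + 1) → Fin N) → K :=
    fun z => antisymmetrizer q (drinfeldJimbo N q) (N + 1) z y with hv
  have hv' : ∀ a : Fin N, (onPair (drinfeldJimbo N q) a).mulVec v = -q⁻¹ • v := fun a => by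
    have h := (hspec a (by omega)).1
    rw [braidGen_eq_onPair, add_mul, smul_one_mul, add_eq_zero_iff_eq_neg, ← neg_smul] at h
    funext z
    exact congrFun (congrFun h z) y
  obtain ⟨i, j, hij, hxij⟩ := Fintype.exists_ne_map_eq_of_card_lt x (by simp)
  change v x = 0
  rcases lt_or_gt_of_ne hij with h | h
  · exact eq_zero_of_drinfeldJimbo_antisymmetric hq0 hq hv' (j - i - 1) x i j
      (by have : (i : ℕ) < j := h; omega) hxij
  · exact eq_zero_of_drinfeldJimbo_antisymmetric hq0 hq hv' (i - j - 1) x j i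
      (by have : (j : ℕ) < i := h; omega) hxij.symm

end DrinfeldJimbo

end QCHN

theorem mainTheorem2 {K : Type*} [Field K] (N : ℕ) (q : K) (hq0 : q ≠ 0)
    (hq : ∀ m : ℕ, 0 < m → q ^ m ≠ 1)
    (R : Matrix (Fin N × Fin N) (Fin N × Fin N) K)
    (hYB : QCHN.IsYangBaxter R) (hHecke : QCHN.IsHecke q R) :
    (∀ k : ℕ, 1 ≤ k →
      QCHN.qNumber q k • QCHN.wedgeLower q R k =
        -∑ j ∈ Finset.range k, (-1 : K) ^ (k - j) •
          QCHN.leftMul (QCHN.sigma q R j) (QCHN.powLower R (k - j))) ∧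
    (∀ k : ℕ, 1 ≤ k →
      QCHN.qNumber q k • QCHN.wedgeUpper q R k =
        -∑ j ∈ Finset.range k, (-1 : K) ^ (k - j) •
          QCHN.rightMul (QCHN.powUpper R (k - j)) (QCHN.sigma q R j)) ∧
    (∀ n : ℕ, QCHN.antisymmetrizer q R (n + 1) = 0 →
      ∑ j ∈ Finset.range (n + 1), (-1 : K) ^ (n + 1 - j) •
          QCHN.leftMul (QCHN.sigma q R j) (QCHN.powLower R (n + 1 - j)) = 0 ∧
      ∑ j ∈ Finset.range (n + 1), (-1 : K) ^ (n + 1 - j) •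
          QCHN.rightMul (QCHN.powUpper R (n + 1 - j)) (QCHN.sigma q R j) = 0) ∧
    (R = QCHN.drinfeldJimbo N q → QCHN.antisymmetrizer q R (N + 1) = 0) := by
  have hlower : ∀ k : ℕ, 1 ≤ k → QCHN.qNumber q k • QCHN.wedgeLower q R k =
      -∑ j ∈ Finset.range k, (-1 : K) ^ (k - j) •
        QCHN.leftMul (QCHN.sigma q R j) (QCHN.powLower R (k - j)) := fun k hk => by
    obtain ⟨n, rfl⟩ := Nat.exists_eq_add_of_le' hk
    exact QCHN.cayleyHamiltonNewton_lower hq0 hq hYB hHecke n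
  have hupper : ∀ k : ℕ, 1 ≤ k → QCHN.qNumber q k • QCHN.wedgeUpper q R k =
      -∑ j ∈ Finset.range k, (-1 : K) ^ (k - j) •
        QCHN.rightMul (QCHN.powUpper R (k - j)) (QCHN.sigma q R j) := fun k hk => by
    obtain ⟨n, rfl⟩ := Nat.exists_eq_add_of_le' hk
    exact QCHN.cayleyHamiltonNewton_upper hq0 hq hYB hHecke n
  refine ⟨hlower, hupper, fun n hn => ⟨?_, ?_⟩, ?_⟩
  · have hw : QCHN.wedgeLower q R (n + 1) = 0 := by
      ext
      simp [QCHN.wedgeLower, QCHN.traceAllButLast, QCHN.antisymProd, hn]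
    rw [← neg_eq_zero, ← hlower (n + 1) (by omega), hw, smul_zero]
  · have hw : QCHN.wedgeUpper q R (n + 1) = 0 := by
      ext
      simp [QCHN.wedgeUpper, QCHN.traceAllButFirst, QCHN.antisymProd, hn]
    rw [← neg_eq_zero, ← hupper (n + 1) (by omega), hw, smul_zero]
  · rintro rfl
    exact QCHN.antisymmetrizer_drinfeldJimbo_eq_zero hq0 hq hYB hHecke
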